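/- Let $n\ge 0$ be an integer, let $d_y\ge d_z\ge 2$ be even integers, and let $\rho\colon\mathbb R^{n+1}\to[0,\infty)$ be a proper smooth function of the form $\rho(\vec y,z)=\rho_y(\vec y)+z^{d_z}$, where $\rho_y(s\vec y)=s^{d_y}\rho_y(\vec y)$ for all $s\in\mathbb R$, $\vec y\in\mathbb R^n$. Let $c>0$, $V=\{\rho<c\}\subset\mathbb R^{n+1}$, and let $\mathcal B_V=(\mathbb R^n/\mathbb Z^n)\times V$ have coordinates $(\vec x,\vec y,z)$, the contact form $\alpha=dz-\sum_j y_j\,dx_j$ and the contact structure $\ker\alpha$. Put $\mathcal Z=\{\vec y=\vec 0,\ z=0\}\subset\mathcal B_V$ and $\mathcal B_V^*=\mathcal B_V\setminus\mathcal Z$. Let $F\colon(-\log c,\infty)\to(-\infty,0]$ be a smooth function such that (i) $F'\le 0$ everywhere; (ii) there is $u_0>-\log c$ such that $F(u)=0$ if and only if $u\le u_0$; (iii) $\int_{u_1}^\infty \frac{du}{F(u)}=-\infty$ for one (equivalently, every) $u_1>u_0$; (iv) $\lim_{u\to\infty}e^{\left(\frac1{d_y}-\frac1{d_z}\right)u}F'(u)=0$;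 (v) $\lim_{u\to\infty}\frac{F'(u)}{F(u)}=0$. Let $H\colon\mathcal B_V^*\to\mathbb R$, $H(\vec x,\vec y,z)=zF(-\log\rho(\vec y,z))$, and let $X_H$ be its contact Hamiltonian vector field, $$X_H=-\sum_j\frac{\partial H}{\partial y_j}\partial_{x_j}+\sum_j\left(\frac{\partial H}{\partial x_j}+y_j\frac{\partial H}{\partial z}\right)\partial_{y_j}+\left(H-\sum_jy_j\frac{\partial H}{\partial y_j}\right)\partial_z .$$ Then the flow $\phi_H^t$ of $X_H$ on $\mathcal B_V^*$ exists, is unique, and is a diffeomorphism of $\mathcal B_V^*$ for every $t\in\mathbb R$. For every $t\in\mathbb R$ the map that equals $\phi_H^t$ on $\mathcal B_V^*$ and the identity on $\mathcal Z$ is a contact homeomorphism $\overline\phi_H^t$ of $\mathcal B_V$, that is, a homeomorphism of $\mathcal B_V$ that is the limit, in the compact-open topology, of a sequence of contactomorphisms of $(\mathcal B_V,\ker\alpha)$. Moreover, if $t>0$ and $\lim_{u\to\infty}F(u)=-\infty$, then there are contactomorphisms $\psi_m\colon\mathcal B_V\to\mathcal B_V$ $(m\in\mathbb N)$, all supported in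 one compact subset of $\mathcal B_V$, that converge to $\overline\phi_H^t$ in the compact-open topology, and smooth functions $f_m\colon\mathcal B_V\to\mathbb R$ with $\psi_m^*\alpha=f_m\alpha$, such that $f_m$ converges uniformly on $\mathcal B_V$ to a continuous function $f\colon\mathcal B_V\to[0,\infty)$ with $(\phi_H^t)^*\alpha=f\alpha$ on $\mathcal B_V^*$ and $f|_{\mathcal Z}=0$. -/

import Mathlib

open Set Filter Topology
open scoped ContDiff

noncomputable section

namespace JetTorus

/-- `ℝⁿ × ℝⁿ × ℝ` with coordinates `(x, y, z)`: the universal cover of `(ℝ/ℤ)ⁿ × ℝⁿ × ℝ`,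
and also the tangent space at each point, in the global frame `∂_{x_j}, ∂_{y_j}, ∂_z`. -/
abbrev Cover (n : ℕ) : Type := (Fin n → ℝ) × (Fin n → ℝ) × ℝ

/-- The manifold `(ℝ/ℤ)ⁿ × ℝⁿ × ℝ` with coordinates `(x, y, z)`. -/
abbrev Jet (n : ℕ) : Type := (Fin n → UnitAddCircle) × (Fin n → ℝ) × ℝ

/-- The covering projection `ℝⁿ × ℝⁿ × ℝ → (ℝ/ℤ)ⁿ × ℝⁿ × ℝ`. -/
def proj {n : ℕ} (p : Cover n) : Jet n := (fun j => (p.1 j : UnitAddCircle), p.2.1, p.2.2)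

/-- The contact form `α = dz - ∑ y_j dx_j`, at the point `p`, in the global frame. -/
def alpha {n : ℕ} (p : Cover n) : Cover n →L[ℝ] ℝ :=
  (ContinuousLinearMap.snd ℝ (Fin n → ℝ) ℝ).comp (ContinuousLinearMap.snd ℝ (Fin n → ℝ) _) -
    ∑ j, p.2.1 j • (ContinuousLinearMap.proj (R := ℝ) (φ := fun _ : Fin n => ℝ) j).comp
      (ContinuousLinearMap.fst ℝ (Fin n → ℝ) ((Fin n → ℝ) × ℝ))

theorem alpha_apply {n : ℕ} (p v : Cover n) :
    alpha p v = v.2.2 - ∑ j, p.2.1 j * v.1 j := by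
  simp [alpha]

/-! ### Smooth maps between open subsets, through local lifts to the cover

As `proj` is a local diffeomorphism, a map `φ` between open subsets of `(ℝ/ℤ)ⁿ × ℝⁿ × ℝ` is smooth
iff near every point `p` of the cover it has a smooth lift `Φ`; the differential of `φ` at `proj p`,
written in the global frame, is then `fderiv ℝ Φ p`, whichever lift is used. -/

/-- `Φ` is smooth at `p` and lifts `φ` near `p`. -/
def IsSmoothLiftAt {n : ℕ} {U W : Set (Jet n)} (φ : U → W) (p : Cover n)
    (Φ : Cover n → Cover n) : Prop :=
  ContDiffAt ℝ ∞ Φ p ∧ ∀ᶠ q in 𝓝 p, ∀ hq : proj q ∈ U, (φ ⟨proj q, hq⟩ : Jet n) = proj (Φ q)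

/-- `φ : U → W` is a smooth map (`U`, `W` open). -/
def IsSmoothMap {n : ℕ} {U W : Set (Jet n)} (φ : U → W) : Prop :=
  ∀ p : Cover n, proj p ∈ U → ∃ Φ, IsSmoothLiftAt φ p Φ

/-- `f : U → ℝ` is a smooth function (`U` open). -/
def IsSmoothFun {n : ℕ} {U : Set (Jet n)} (f : U → ℝ) : Prop :=
  ∀ p : Cover n, proj p ∈ U → ∃ g : Cover n → ℝ, ContDiffAt ℝ ∞ g p ∧
    ∀ᶠ q in 𝓝 p, ∀ hq : proj q ∈ U, f ⟨proj q, hq⟩ = g q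

/-- `φ : U → U` is a diffeomorphism (`U` open). -/
def IsDiffeo {n : ℕ} {U : Set (Jet n)} (φ : U → U) : Prop :=
  IsSmoothMap φ ∧ ∃ ψ : U → U, IsSmoothMap ψ ∧
    Function.LeftInverse ψ φ ∧ Function.RightInverse ψ φ

/-- The smooth map `φ` satisfies `φ^* α = f α` on `U`. -/
def PullsBackAlpha {n : ℕ} {U W : Set (Jet n)} (φ : U → W) (f : U → ℝ) : Prop :=
  ∀ (p : Cover n) (hp : proj p ∈ U), ∃ Φ, IsSmoothLiftAt φ p Φ ∧
    ∀ v, alpha (Φ p) (fderiv ℝ Φ p v) = f ⟨proj p, hp⟩ * alpha p v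

/-- `φ : U → U` is a contactomorphism of `(U, ker α)`: a diffeomorphism whose differential maps
`ker α` at each point onto `ker α` at the image point. -/
def IsContactomorphism {n : ℕ} {U : Set (Jet n)} (φ : U → U) : Prop :=
  IsDiffeo φ ∧ ∀ p : Cover n, proj p ∈ U → ∃ Φ, IsSmoothLiftAt φ p Φ ∧
    (LinearMap.ker (alpha p : Cover n →ₗ[ℝ] ℝ)).map (fderiv ℝ Φ p : Cover n →ₗ[ℝ] Cover n) =
      LinearMap.ker (alpha (Φ p) : Cover n →ₗ[ℝ] ℝ)

/-- The maps `ψ m` converge to `ψ` in the compact-open topology. -/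
def C0Tendsto {n : ℕ} {U : Set (Jet n)} (ψs : ℕ → U ≃ₜ U) (ψ : U ≃ₜ U) : Prop :=
  Tendsto (fun m => (ψs m : C(U, U))) atTop (𝓝 (ψ : C(U, U)))

/-- A contact homeomorphism of `(U, ker α)`: a homeomorphism that is the limit, in the
compact-open topology, of a sequence of contactomorphisms. -/
def IsContactHomeo {n : ℕ} {U : Set (Jet n)} (ψ : U ≃ₜ U) : Prop :=
  ∃ ψs : ℕ → U ≃ₜ U, (∀ m, IsContactomorphism (ψs m)) ∧ C0Tendsto ψs ψ

/-! ### Contact Hamiltonian flows -/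

/-- The contact Hamiltonian vector field of `H` with respect to `α`, in the global frame:
`X_H = -∑ H_{y_j} ∂_{x_j} + ∑ (H_{x_j} + y_j H_z) ∂_{y_j} + (H - ∑ y_j H_{y_j}) ∂_z`. -/
def hamVF {n : ℕ} (H : Jet n → ℝ) (p : Cover n) : Cover n :=
  let dH : Cover n →L[ℝ] ℝ := fderiv ℝ (fun q => H (proj q)) p
  (fun j => -dH (0, Pi.single j 1, 0),
   fun j => dH (Pi.single j 1, 0, 0) + p.2.1 j * dH (0, 0, 1),
   H (proj p) - ∑ j, p.2.1 j * dH (0, Pi.single j 1, 0))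

/-- A curve `γ : ℝ → U` is an integral curve of `X_H`. -/
def IsHamCurve {n : ℕ} {U : Set (Jet n)} (H : Jet n → ℝ) (γ : ℝ → U) : Prop :=
  ∃ Γ : ℝ → Cover n, ∀ t, proj (Γ t) = (γ t : Jet n) ∧ HasDerivAt Γ (hamVF H (Γ t)) t

/-- `φ` is the (complete) Hamiltonian flow of `H` on the open set `U`. -/
def IsHamFlow {n : ℕ} {U : Set (Jet n)} (H : Jet n → ℝ) (φ : ℝ → U → U) : Prop :=
  ∀ p, φ 0 p = p ∧ IsHamCurve H (fun t => φ t p)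

/-! ### The neighborhood `B_V` and the Hamiltonian -/

/-- `ρ(y, z) = ρ_y(y) + z ^ d_z`. -/
def rho {n : ℕ} (ρy : (Fin n → ℝ) → ℝ) (dz : ℕ) (w : (Fin n → ℝ) × ℝ) : ℝ := ρy w.1 + w.2 ^ dz

/-- `B_V = (ℝ/ℤ)ⁿ × V`, where `V = {ρ < c}`. -/
def BV {n : ℕ} (ρ : (Fin n → ℝ) × ℝ → ℝ) (c : ℝ) : Set (Jet n) := {p | ρ p.2 < c}

/-- `B_V^*`, the complement in `B_V` of the zero section `{y = 0, z = 0}`. -/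
def BVstar {n : ℕ} (ρ : (Fin n → ℝ) × ℝ → ℝ) (c : ℝ) : Set (Jet n) := {p | p ∈ BV ρ c ∧ p.2 ≠ 0}

theorem BVstar_subset {n : ℕ} (ρ : (Fin n → ℝ) × ℝ → ℝ) (c : ℝ) : BVstar ρ c ⊆ BV ρ c :=
  fun _ h => h.1

/-- `H_{F,ρ}(x, y, z) = z F(-log ρ(y, z))`; only its values on `B_V^*` matter. -/
def ham {n : ℕ} (F : ℝ → ℝ) (ρ : (Fin n → ℝ) × ℝ → ℝ) (p : Jet n) : ℝ :=
  p.2.2 * F (-Real.log (ρ p.2))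

/-- Requirements on `ρ_y`, `d_y`, `d_z`. -/
structure IsAdmissibleRho {n : ℕ} (ρy : (Fin n → ℝ) → ℝ) (dy dz : ℕ) : Prop where
  even_dy : Even dy
  even_dz : Even dz
  two_le : 2 ≤ dz
  dz_le_dy : dz ≤ dy
  homogeneous : ∀ (s : ℝ) (y : Fin n → ℝ), ρy (s • y) = s ^ dy * ρy y
  smooth : ContDiff ℝ ∞ (rho ρy dz)
  nonneg : ∀ w, 0 ≤ rho ρy dz w
  proper : IsProperMap (rho ρy dz)

/-- Requirements on `F : (-log c, ∞) → (-∞, 0]`; values outside this interval play no role. -/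
structure IsAdmissibleF (F : ℝ → ℝ) (c : ℝ) (dy dz : ℕ) : Prop where
  smooth : ContDiffOn ℝ ∞ F (Ioi (-Real.log c))
  nonpos : ∀ u, -Real.log c < u → F u ≤ 0
  deriv_nonpos : ∀ u, -Real.log c < u → deriv F u ≤ 0
  exists_u0 : ∃ u₀, -Real.log c < u₀ ∧ (∀ u, -Real.log c < u → (F u = 0 ↔ u ≤ u₀)) ∧
    ∃ u₁, u₀ < u₁ ∧ Tendsto (fun R => ∫ u in u₁..R, 1 / F u) atTop atBot
  decay : Tendsto (fun u => Real.exp ((1 / (dy : ℝ) - 1 / (dz : ℝ)) * u) * deriv F u) atTop (𝓝 0)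
  log_deriv : Tendsto (fun u => deriv F u / F u) atTop (𝓝 0)

/-! ### The field `hamVF H` is the one with `α(X_H) = H` and `ι_{X_H} dα = dH(R) α - dH`

Here `R = ∂_z` is the Reeb field. -/

/-- `dα = ∑ dx_j ∧ dy_j`. -/
def dAlpha {n : ℕ} (v w : Cover n) : ℝ := ∑ j, (v.1 j * w.2.1 j - v.2.1 j * w.1 j)

/-- `dα` is the exterior derivative of `α`. -/
theorem dAlpha_eq {n : ℕ} (p v w : Cover n) :
    dAlpha v w = fderiv ℝ (fun q => alpha q w) p v - fderiv ℝ (fun q => alpha q v) p w := by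
  have key : ∀ a b : Cover n, fderiv ℝ (fun q : Cover n => alpha q a) p b
      = -∑ j, b.2.1 j * a.1 j := by
    intro a b
    let L : Cover n →ₗ[ℝ] ℝ :=
      { toFun := fun q => -∑ j, q.2.1 j * a.1 j
        map_add' := by
          intro x y
          simp [add_mul, Finset.sum_add_distrib]
          ring
        map_smul' := by
          intro r x
          simp [Finset.mul_sum, mul_assoc] }
    have h : HasFDerivAt (fun q : Cover n => alpha q a) (LinearMap.toContinuousLinearMap L) p := by
      have h1 := (LinearMap.toContinuousLinearMap L).hasFDerivAt (x := p)
      have h2 := h1.const_add a.2.2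
      refine h2.congr_of_eventuallyEq (Eventually.of_forall fun q => ?_)
      simp only [alpha_apply]
      simp [L, sub_eq_add_neg]
    rw [h.fderiv]
    simp [L]
  rw [key, key, dAlpha, Finset.sum_sub_distrib]
  have h1 : ∑ j, v.1 j * w.2.1 j = ∑ j, w.2.1 j * v.1 j :=
    Finset.sum_congr rfl fun j _ => mul_comm _ _
  rw [h1]
  ring

theorem hamVF_unique {n : ℕ} (H : Jet n → ℝ) (p X : Cover n) :
    X = hamVF H p ↔ alpha p X = H (proj p) ∧ ∀ v : Cover n, dAlpha X v =
      fderiv ℝ (fun q => H (proj q)) p (0, 0, 1) * alpha p v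
        - fderiv ℝ (fun q => H (proj q)) p v := by
  set dH : Cover n →L[ℝ] ℝ := fderiv ℝ (fun q => H (proj q)) p with hdH
  have hsplit : ∀ v : Cover n, dH v = (∑ j, v.1 j * dH (Pi.single j 1, 0, 0))
      + (∑ j, v.2.1 j * dH (0, Pi.single j 1, 0)) + v.2.2 * dH (0, 0, 1) := by
    intro v
    have hv : v = (∑ j, v.1 j • ((Pi.single j 1, 0, 0) : Cover n))
      + (∑ j, v.2.1 j • ((0, Pi.single j 1, 0) : Cover n)) + v.2.2 • ((0, 0, 1) : Cover n) := by
      refine Prod.ext ?_ (Prod.ext ?_ ?_)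
      · ext i
        simp [Prod.fst_sum, Finset.sum_apply, Pi.single_apply]
      · ext i
        simp [Prod.fst_sum, Prod.snd_sum, Finset.sum_apply, Pi.single_apply]
      · simp [Prod.snd_sum]
    conv_lhs => rw [hv]
    simp only [map_add, map_sum, map_smul, smul_eq_mul]
  constructor
  · rintro rfl
    refine ⟨?_, fun v => ?_⟩
    · simp only [alpha_apply, hamVF, ← hdH]
      simp [Finset.sum_neg_distrib]
    · rw [hsplit v, alpha_apply, dAlpha]
      simp only [hamVF, ← hdH]
      have : ∀ j : Fin n, -dH (0, Pi.single j 1, 0) * v.2.1 j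
          - (dH (Pi.single j 1, 0, 0) + p.2.1 j * dH (0, 0, 1)) * v.1 j
          = -(v.2.1 j * dH (0, Pi.single j 1, 0)) - v.1 j * dH (Pi.single j 1, 0, 0)
            - dH (0, 0, 1) * (p.2.1 j * v.1 j) := fun j => by ring
      simp only [this, Finset.sum_sub_distrib, Finset.sum_neg_distrib, ← Finset.mul_sum]
      ring
  · rintro ⟨h1, h2⟩
    have hx : ∀ j, X.1 j = -dH (0, Pi.single j 1, 0) := by
      intro j
      have := h2 (0, Pi.single j 1, 0)
      simpa [dAlpha, alpha_apply, Pi.single_apply] using this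
    have hy : ∀ j, X.2.1 j = dH (Pi.single j 1, 0, 0) + p.2.1 j * dH (0, 0, 1) := by
      intro j
      have := h2 (Pi.single j 1, 0, 0)
      simp [dAlpha, alpha_apply, Pi.single_apply] at this
      linarith
    refine Prod.ext (funext hx) (Prod.ext (funext hy) ?_)
    rw [alpha_apply] at h1
    simp only [hx, mul_neg, Finset.sum_neg_distrib] at h1
    simp only [hamVF, ← hdH]
    linarith

end JetTorus

end

/-! Put `g r = F (-log r)`, extended by zero past `r₀ = exp (-u₀) < c`, so that `H = z g(ρ)`.
Because `ρ_y` is homogeneous, the terms with `g'` cancel in the derivative of `ρ` along the flow,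
and `ρ' = g(ρ) (d_y ρ_y + d_z z^{d_z})` (`hasDerivAt_rho_flow`). So `ρ` never increases. A primitive
`Θ` of `1 / (r g)` serves as a clock: `Θ(ρ)` grows at rate at most `d_y`, while `Θ → ∞` at `0` by
(iii). Hence no orbit reaches the zero section in finite time; none leaves `V` either, since the
field vanishes for `ρ ≥ r₀`.

To obtain contactomorphisms of the whole of `B_V`, replace `g` by `g ∘ clamp δ`, which is constant
near `0`. The truncated field is smooth, independent of `x` and compactly supported in `(y, z)`, so
it is globally Lipschitz and has a smooth complete flow. Truncation only decreases `|g|`, so the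
clock estimate `clock_le` is uniform in `δ`. On `{ρ ≥ ε}` and for bounded times the truncated flows
therefore stay away from the zero section and become independent of `δ` once `δ` is small
(`exists_stable`). Their eventual value defines the limit flow, and uniqueness follows from the same
comparison.

Near the zero section the `(y, z)` part of an orbit is small because `ρ` is. The `x` part moves at
speed at most a constant times `ρ^{1/d_z - 1/d_y} ρ g'(ρ)`, which tends to `0` by (iv)
(`exists_norm_field_fst_le`). The truncated flows are thus uniformly close to the identity there,
and together with stabilization this gives uniform convergence to the limit flow, extended by the
identity.

The conformal factor is `exp ∫ H_z` along the orbit, with `H_z = g + d_z z^{d_z} g' ≤ g + d_z ρ g'`.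
By (v) the second term is negligible against `g`, so if `g → -∞` and `t > 0` the factors are
uniformly small near the zero section (`exists_truncFactor_le`); elsewhere they stabilize.
Everything is done equivariantly on the cover and then descended. -/

noncomputable section

/-! ### Smooth flows of globally Lipschitz vector fields -/

namespace LipschitzFlow

open Metric Manifold
open scoped NNReal

section Existence

variable {E : Type*} [NormedAddCommGroup E] [NormedSpace ℝ E]

/-- `φ` is a complete flow of the vector field `v`. -/
structure IsGlobalFlow (v : E → E) (φ : ℝ → E → E) : Prop where
  zero : ∀ x, φ 0 x = x
  deriv : ∀ x t, HasDerivAt (fun s => φ s x) (v (φ t x)) t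

/-- A global Lipschitz constant gives an existence time independent of the starting point, and local
solutions with a uniform existence time extend to all times. -/
theorem exists_isGlobalFlow [CompleteSpace E] {v : E → E} {K : ℝ≥0} (hv1 : ContDiff ℝ 1 v)
    (hv : LipschitzWith K v) : ∃ φ, IsGlobalFlow v φ := by
  -- On the ball of radius `‖v x‖ + 1` about `x` the field is bounded by `‖v x‖ + K (‖v x‖ + 1)`;
  -- this `ε` times that bound is at most the radius, whatever `x` is.
  set ε : ℝ := 1 / (2 * (K + 1)) with hε
  have hε0 : 0 < ε := by positivity
  have hloc : ∀ x : E, ∃ γ : ℝ → E, γ 0 = x ∧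
      ∀ t ∈ Ioo (-ε) ε, HasDerivAt γ (v (γ t)) t := by
    intro x
    have hmem : (0 : ℝ) ∈ Icc (-ε) ε := ⟨by linarith, hε0.le⟩
    have hPL : IsPicardLindelof (fun _ : ℝ => v) (⟨0, hmem⟩ : Icc (-ε) ε) x
        (‖v x‖₊ + 1) 0 (‖v x‖₊ + K * (‖v x‖₊ + 1)) K := by
      refine IsPicardLindelof.of_time_independent ?_ hv.lipschitzOnWith ?_
      · intro y hy
        have h1 := hv.dist_le_mul y x
        rw [mem_closedBall] at hy
        have h2 : ‖v y‖ ≤ ‖v x‖ + dist (v y) (v x) := by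
          rw [dist_eq_norm]
          have := norm_add_le (v x) (v y - v x)
          simpa using this
        push_cast at hy ⊢
        have h3 : (K : ℝ) * dist y x ≤ K * (‖v x‖ + 1) := by gcongr
        linarith
      · have h0 : max (ε - 0) (0 - -ε) = ε := by simp
        simp only [h0]
        push_cast
        simp only [sub_zero]
        rw [hε, mul_one_div, div_le_iff₀ (by positivity)]
        have h1 : (0 : ℝ) ≤ K := K.2
        nlinarith [norm_nonneg (v x), mul_nonneg h1 (norm_nonneg (v x))]
    obtain ⟨γ, h0, hγ⟩ := hPL.exists_eq_forall_mem_Icc_hasDerivWithinAt₀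
    exact ⟨γ, h0, fun t ht => (hγ t (Ioo_subset_Icc_self ht)).hasDerivAt
      (Icc_mem_nhds ht.1 ht.2)⟩
  have hcm : ∀ w : (x : E) → TangentSpace 𝓘(ℝ, E) x, (∀ x, w x = v x) →
      ContMDiff 𝓘(ℝ, E) 𝓘(ℝ, E).tangent 1 (fun x => (⟨x, w x⟩ : TangentBundle 𝓘(ℝ, E) E)) := by
    intro w hw x
    rw [contMDiffAt_vectorSpace_iff_contDiffAt]
    obtain rfl : w = v := funext hw
    exact hv1.contDiffAt
  have key := exists_isMIntegralCurve_of_isMIntegralCurveOn (I := 𝓘(ℝ, E)) (M := E)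
    (hcm v fun _ => rfl) hε0
    (by
      intro x
      obtain ⟨γ, h0, hγ⟩ := hloc x
      refine ⟨γ, h0, fun t ht => ?_⟩
      exact (hγ t ht).hasFDerivAt.hasMFDerivAt.hasMFDerivWithinAt)
  choose φ h0 hφ using key
  refine ⟨fun t x => φ x t, h0, fun x t => ?_⟩
  have h1 : HasFDerivAt (φ x)
      (ContinuousLinearMap.smulRight (1 : ℝ →L[ℝ] ℝ) (v (φ x t)) : ℝ →L[ℝ] E) t :=
    hasMFDerivAt_iff_hasFDerivAt.1 (hφ x t)
  simpa using h1.hasDerivAt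

namespace IsGlobalFlow

variable {v : E → E} {φ : ℝ → E → E} {K : ℝ≥0}

theorem neg (h : IsGlobalFlow v φ) : IsGlobalFlow (-v) (fun t => φ (-t)) where
  zero x := by simpa using h.zero x
  deriv x t := by
    have := (h.deriv x (-t)).scomp t (hasDerivAt_neg t)
    simpa [Function.comp_def] using this

theorem continuous_curve (h : IsGlobalFlow v φ) (x : E) : Continuous fun t => φ t x :=
  continuous_iff_continuousAt.2 fun t => (h.deriv x t).continuousAt

theorem eq_of_hasDerivAt_Ioo (h : IsGlobalFlow v φ) (hv : LipschitzWith K v) {γ : ℝ → E}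
    {a b t₀ : ℝ} (ht₀ : t₀ ∈ Ioo a b) (hγ : ∀ t ∈ Ioo a b, HasDerivAt γ (v (γ t)) t)
    {x : E} (h0 : γ t₀ = φ t₀ x) {t : ℝ} (ht : t ∈ Ioo a b) : γ t = φ t x :=
  ODE_solution_unique_of_mem_Ioo (v := fun _ => v) (s := fun _ => univ) (K := K)
    (fun _ _ => hv.lipschitzOnWith) ht₀ (fun s hs => ⟨hγ s hs, trivial⟩)
    (fun s _ => ⟨h.deriv x s, trivial⟩) h0 ht

theorem eq_of_hasDerivAt (h : IsGlobalFlow v φ) (hv : LipschitzWith K v) {γ : ℝ → E}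
    (hγ : ∀ t, HasDerivAt γ (v (γ t)) t) (t : ℝ) : γ t = φ t (γ 0) :=
  h.eq_of_hasDerivAt_Ioo hv (a := -(|t| + 1)) (b := |t| + 1) (t₀ := 0)
    ⟨by linarith [abs_nonneg t], by linarith [abs_nonneg t]⟩ (fun s _ => hγ s) (h.zero _).symm
    ⟨by linarith [neg_abs_le t], by linarith [le_abs_self t]⟩

theorem map_add (h : IsGlobalFlow v φ) (hv : LipschitzWith K v) (s t : ℝ) (x : E) :
    φ (s + t) x = φ s (φ t x) := by
  have := h.eq_of_hasDerivAt hv (γ := fun r => φ (r + t) x)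
    (fun r => (h.deriv x (r + t)).comp_add_const r t) s
  simpa using this

theorem neg_comp (h : IsGlobalFlow v φ) (hv : LipschitzWith K v) (t : ℝ) (x : E) :
    φ (-t) (φ t x) = x := by
  rw [← h.map_add hv, neg_add_cancel, h.zero]

theorem comp_neg (h : IsGlobalFlow v φ) (hv : LipschitzWith K v) (t : ℝ) (x : E) :
    φ t (φ (-t) x) = x := by
  rw [← h.map_add hv, add_neg_cancel, h.zero]

theorem eq_self_of_eq_zero (h : IsGlobalFlow v φ) (hv : LipschitzWith K v) {x : E}
    (hx : v x = 0) (t : ℝ) : φ t x = x := by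
  have := h.eq_of_hasDerivAt hv (γ := fun _ => x) (fun r => by
    simpa [hx] using hasDerivAt_const r x) t
  exact this.symm

theorem dist_le (h : IsGlobalFlow v φ) (hv : LipschitzWith K v) {t : ℝ} (ht : 0 ≤ t) (x y : E) :
    dist (φ t x) (φ t y) ≤ dist x y * Real.exp (K * t) := by
  have := dist_le_of_trajectories_ODE (v := fun _ => v) (K := K) (f := fun s => φ s x)
    (g := fun s => φ s y) (a := 0) (b := t) (δ := dist x y) (fun _ => hv)
    (h.continuous_curve x).continuousOn (fun s _ => (h.deriv x s).hasDerivWithinAt)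
    (h.continuous_curve y).continuousOn (fun s _ => (h.deriv y s).hasDerivWithinAt)
    (by simp [h.zero]) t ⟨ht, le_rfl⟩
  simpa using this

/-- If `D` solves the variational equation along the orbit of `x`, then `D t` is the derivative of
the time-`t` map at `x`. -/
theorem hasFDerivAt_of_variational (h : IsGlobalFlow v φ) (hv : LipschitzWith K v)
    (hv1 : ContDiff ℝ 1 v) {t : ℝ} (ht : 0 ≤ t) {x : E} {D : ℝ → E →L[ℝ] E}
    (hD0 : D 0 = ContinuousLinearMap.id ℝ E)
    (hD : ∀ s ∈ Icc 0 t, HasDerivAt D ((fderiv ℝ v (φ s x)).comp (D s)) s) :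
    HasFDerivAt (φ t) (D t) x := by
  have hdiff : Differentiable ℝ v := hv1.differentiable (by norm_num)
  have hcd : Continuous (fderiv ℝ v) := hv1.continuous_fderiv (by norm_num)
  have hS : IsCompact ((fun s => φ s x) '' Icc 0 t) :=
    isCompact_Icc.image (h.continuous_curve x)
  rw [hasFDerivAt_iff_isLittleO, Asymptotics.isLittleO_iff]
  intro c hc
  -- With zero initial error the Grönwall bound is linear in the forcing term. A linearization error
  -- `ε` for `v` along the orbit thus gives the final error `ε * M * ‖y - x‖`, and `ε = c / (M + 1)`
  -- is small enough.
  set M : ℝ := gronwallBound 0 K (Real.exp (K * t)) t with hM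
  have hM0 : 0 ≤ M := by
    have := gronwallBound_mono (δ := 0) (K := K) (ε := Real.exp (K * t)) le_rfl
      (Real.exp_pos _).le K.2 ht
    rwa [gronwallBound_x0] at this
  set ε : ℝ := c / (M + 1) with hε
  have hε0 : 0 < ε := by positivity
  obtain ⟨δ, hδ, hunif⟩ := Metric.mem_uniformity_dist.1
    (hS.uniformContinuousAt_of_continuousAt (fderiv ℝ v) (fun a _ => hcd.continuousAt)
      (Metric.dist_mem_uniformity hε0))
  have hnear : ∀ᶠ y in 𝓝 x, dist y x * Real.exp (K * t) < δ := by
    have : Tendsto (fun y => dist y x * Real.exp (K * t)) (𝓝 x) (𝓝 (dist x x * Real.exp (K * t))) :=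
      ((continuous_id.dist continuous_const).mul continuous_const).tendsto x
    rw [dist_self, zero_mul] at this
    exact this.eventually (gt_mem_nhds hδ)
  filter_upwards [hnear] with y hy
  have hclose : ∀ s ∈ Icc 0 t, dist (φ s y) (φ s x) ≤ dist y x * Real.exp (K * t) := by
    intro s hs
    refine (h.dist_le hv hs.1 y x).trans ?_
    gcongr
    exact hs.2
  have hG := norm_le_gronwallBound_of_norm_deriv_right_le
    (f := fun s => φ s y - φ s x - D s (y - x))
    (f' := fun s => v (φ s y) - v (φ s x) - (fderiv ℝ v (φ s x)) (D s (y - x)))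
    (δ := 0) (K := K) (ε := ε * (dist y x * Real.exp (K * t))) (a := 0) (b := t)
    ?_ ?_ ?_ ?_ t ⟨ht, le_rfl⟩
  · have hsc : gronwallBound 0 K (ε * (dist y x * Real.exp (K * t))) (t - 0)
        = ε * dist y x * M := by
      rw [hM, sub_zero]
      by_cases hK : (K : ℝ) = 0
      · simp only [hK, gronwallBound_K0]; ring
      · simp only [gronwallBound_of_K_ne_0 hK]; ring
    rw [hsc] at hG
    refine hG.trans ?_
    rw [dist_eq_norm, hε]
    have : c / (M + 1) * M ≤ c := by
      rw [div_mul_eq_mul_div, div_le_iff₀ (by positivity)]; nlinarith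
    calc c / (M + 1) * ‖y - x‖ * M = (c / (M + 1) * M) * ‖y - x‖ := by ring
      _ ≤ c * ‖y - x‖ := by gcongr
  · have hDc : ContinuousOn D (Icc 0 t) := fun s hs => (hD s hs).continuousAt.continuousWithinAt
    exact ((h.continuous_curve y).sub (h.continuous_curve x)).continuousOn.sub
      (hDc.clm_apply continuousOn_const)
  · intro s hs
    have h1 := (hD s ⟨hs.1, hs.2.le⟩).clm_apply (hasDerivAt_const s (y - x))
    have h2 := ((h.deriv y s).fun_sub (h.deriv x s)).fun_sub h1
    simpa using h2.hasDerivWithinAt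
  · simp [h.zero, hD0]
  · intro s hs
    have hs' : s ∈ Icc 0 t := ⟨hs.1, hs.2.le⟩
    have hmv : ‖v (φ s y) - v (φ s x) - (fderiv ℝ v (φ s x)) (φ s y - φ s x)‖
        ≤ ε * ‖φ s y - φ s x‖ := by
      refine Convex.norm_image_sub_le_of_norm_fderiv_le' (𝕜 := ℝ) (s := ball (φ s x) δ)
        (fun z _ => hdiff z) ?_ (convex_ball _ _) (mem_ball_self hδ) ?_
      · intro z hz
        have := hunif (a := φ s x) (b := z) (by rw [dist_comm]; exact hz) ⟨s, hs', rfl⟩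
        rw [← dist_eq_norm, dist_comm]
        exact le_of_lt this
      · exact (hclose s hs').trans_lt hy
    have hop : ‖fderiv ℝ v (φ s x)‖ ≤ K := norm_fderiv_le_of_lipschitz ℝ hv
    have hsplit : v (φ s y) - v (φ s x) - (fderiv ℝ v (φ s x)) (D s (y - x))
        = (fderiv ℝ v (φ s x)) (φ s y - φ s x - D s (y - x))
          + (v (φ s y) - v (φ s x) - (fderiv ℝ v (φ s x)) (φ s y - φ s x)) := by
      simp only [map_sub]; abel
    rw [hsplit]
    refine (norm_add_le _ _).trans (add_le_add ?_ (hmv.trans ?_))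
    · exact ((fderiv ℝ v (φ s x)).le_opNorm _).trans (by gcongr)
    · gcongr
      rw [← dist_eq_norm]
      exact hclose s hs'

end IsGlobalFlow

end Existence

end LipschitzFlow

/-! ### Smooth dependence on initial conditions -/

namespace LipschitzFlow

open Metric
open scoped NNReal

universe u

namespace IsGlobalFlow

/-- Near `x₀` and for times in `[0, T]`, the variational equation is solved by the flow of a smooth
compactly supported vector field on `E × (E →L[ℝ] E)`. -/
theorem exists_variational_flow {E : Type u} [NormedAddCommGroup E] [NormedSpace ℝ E]
    [FiniteDimensional ℝ E] {v : E → E} {φ : ℝ → E → E} {K : ℝ≥0}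
    (h : IsGlobalFlow v φ) (hv : LipschitzWith K v) (hvs : ContDiff ℝ ∞ v) (x₀ : E) {T : ℝ}
    (hT : 0 ≤ T) :
    ∃ (w : E × (E →L[ℝ] E) → E × (E →L[ℝ] E)) (Ψ : ℝ → E × (E →L[ℝ] E) → E × (E →L[ℝ] E))
      (C : ℝ≥0), ContDiff ℝ ∞ w ∧ LipschitzWith C w ∧ IsGlobalFlow w Ψ ∧
      ∀ x ∈ ball x₀ 1, ∀ t ∈ Icc 0 T, HasDerivAt
        (fun s => (Ψ s (x, ContinuousLinearMap.id ℝ E)).2)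
        ((fderiv ℝ v (φ t x)).comp (Ψ t (x, ContinuousLinearMap.id ℝ E)).2) t := by
  -- The field `(x, D) ↦ (v x, v' x ∘ D)` has linear growth but need not be Lipschitz, so it is cut
  -- off by a bump function. `R` bounds the solutions starting in `ball x₀ 1 × {id}` up to time `T`,
  -- with or without the cutoff, so that the cutoff is never felt there.
  set R : ℝ := gronwallBound (‖x₀‖ + 1 + ‖ContinuousLinearMap.id ℝ E‖) K ‖v 0‖ T with hR
  have hRx : ∀ t ∈ Icc 0 T,
      gronwallBound (‖x₀‖ + 1 + ‖ContinuousLinearMap.id ℝ E‖) K ‖v 0‖ t ≤ R := fun t ht =>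
    gronwallBound_mono (by positivity) (norm_nonneg _) K.2 ht.2
  have hR0 : 0 < R := by
    have := hRx 0 ⟨le_rfl, hT⟩
    rw [gronwallBound_x0] at this
    have h1 := norm_nonneg x₀
    have h2 := norm_nonneg (ContinuousLinearMap.id ℝ E)
    linarith
  let χ : ContDiffBump (0 : E × (E →L[ℝ] E)) := ⟨R, R + 1, hR0, by linarith⟩
  let w : E × (E →L[ℝ] E) → E × (E →L[ℝ] E) :=
    fun p => χ p • (v p.1, (fderiv ℝ v p.1).comp p.2)
  have hw : ContDiff ℝ ∞ w := by
    refine χ.contDiff.smul ((hvs.comp contDiff_fst).prodMk ?_)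
    exact ((hvs.fderiv_right (m := ∞) (by simp)).comp contDiff_fst).clm_comp contDiff_snd
  have hwc : HasCompactSupport w := χ.hasCompactSupport.smul_right
  obtain ⟨C, hC⟩ := hw.lipschitzWith_of_hasCompactSupport hwc (by simp)
  obtain ⟨Ψ, hΨ⟩ := exists_isGlobalFlow (hw.of_le (by simp)) hC
  refine ⟨w, Ψ, C, hw, hC, hΨ, fun x hx => ?_⟩
  set c : ℝ → E × (E →L[ℝ] E) := fun t => Ψ t (x, ContinuousLinearMap.id ℝ E) with hc
  have hcd : ∀ t, HasDerivAt c (w (c t)) t := fun t => hΨ.deriv _ t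
  have hw_le : ∀ p, ‖w p‖ ≤ K * ‖p‖ + ‖v 0‖ := by
    intro p
    have h1 : ‖v p.1‖ ≤ K * ‖p‖ + ‖v 0‖ := by
      have h2 := hv.norm_sub_le p.1 0
      have h3 : ‖v p.1‖ ≤ ‖v p.1 - v 0‖ + ‖v 0‖ := by
        simpa using norm_add_le (v p.1 - v 0) (v 0)
      have h4 : (K : ℝ) * ‖p.1 - 0‖ ≤ K * ‖p‖ := by
        rw [sub_zero]; gcongr; exact norm_fst_le p
      linarith
    have h2 : ‖(fderiv ℝ v p.1).comp p.2‖ ≤ K * ‖p‖ + ‖v 0‖ := by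
      refine (ContinuousLinearMap.opNorm_comp_le _ _).trans ?_
      have h3 : ‖fderiv ℝ v p.1‖ ≤ K := norm_fderiv_le_of_lipschitz ℝ hv
      have h4 := norm_snd_le p
      have : ‖fderiv ℝ v p.1‖ * ‖p.2‖ ≤ K * ‖p‖ := by gcongr
      linarith [norm_nonneg (v 0)]
    rw [norm_smul, Real.norm_of_nonneg χ.nonneg]
    calc χ p * _ ≤ 1 * ‖(v p.1, (fderiv ℝ v p.1).comp p.2)‖ := by
          gcongr
          exact χ.le_one
      _ ≤ _ := by rw [one_mul]; exact max_le h1 h2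
  have hcR : ∀ t ∈ Icc 0 T, ‖c t‖ ≤ R := by
    intro t ht
    have := norm_le_gronwallBound_of_norm_deriv_right_le (f := c) (f' := fun s => w (c s))
      (δ := ‖x₀‖ + 1 + ‖ContinuousLinearMap.id ℝ E‖) (K := K) (ε := ‖v 0‖) (a := 0) (b := T)
      (hΨ.continuous_curve _).continuousOn (fun s _ => (hcd s).hasDerivWithinAt) ?_
      (fun s _ => hw_le _) t ht
    · rw [sub_zero] at this
      exact this.trans (hRx t ht)
    · have hxn : ‖x‖ ≤ ‖x₀‖ + 1 := by
        have h1 : ‖x - x₀‖ < 1 := by simpa [dist_eq_norm] using hx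
        have h2 := norm_add_le x₀ (x - x₀)
        rw [add_sub_cancel] at h2
        linarith
      rw [hc]
      simp only [hΨ.zero]
      refine max_le ?_ ?_
      · simpa using hxn.trans (by linarith [norm_nonneg (ContinuousLinearMap.id ℝ E)])
      · simp only
        linarith [norm_nonneg x₀]
  have hcd' : ∀ t ∈ Icc 0 T,
      HasDerivAt c (v (c t).1, (fderiv ℝ v (c t).1).comp (c t).2) t := by
    intro t ht
    have h1 : χ (c t) = 1 := χ.one_of_mem_closedBall (by simpa using hcR t ht)
    have := hcd t
    simpa [w, h1] using this
  have hfst : ∀ t ∈ Icc 0 T, (c t).1 = φ t x := by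
    intro t ht
    refine ODE_solution_unique (v := fun _ => v) (K := K) (f := fun s => (c s).1)
      (g := fun s => φ s x) (a := 0) (b := T) (fun _ => hv)
      (hΨ.continuous_curve _).fst.continuousOn
      (fun s hs => (HasDerivAt.hasDerivWithinAt
        ((ContinuousLinearMap.fst ℝ E (E →L[ℝ] E)).hasFDerivAt.comp_hasDerivAt s
          (hcd' s ⟨hs.1, hs.2.le⟩)) :))
      (h.continuous_curve x).continuousOn (fun s _ => (h.deriv x s).hasDerivWithinAt) ?_ ht
    simp [hc, hΨ.zero, h.zero]
  intro t ht
  have := (ContinuousLinearMap.snd ℝ E (E →L[ℝ] E)).hasFDerivAt.comp_hasDerivAt t (hcd' t ht)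
  rwa [hfst t ht] at this

/-- The derivative of the flow is a component of the flow of another smooth Lipschitz field, on `E ×
(E →L[ℝ] E)`. Induction on `k` therefore works if `E` and `v` are allowed to vary. -/
theorem contDiff_nat_of_nonneg (k : ℕ) : ∀ {E : Type u} [NormedAddCommGroup E] [NormedSpace ℝ E]
    [FiniteDimensional ℝ E] {v : E → E} {φ : ℝ → E → E} {K : ℝ≥0}, IsGlobalFlow v φ →
    LipschitzWith K v → ContDiff ℝ ∞ v → ∀ {t : ℝ}, 0 ≤ t → ContDiff ℝ k (φ t) := by
  induction k with
  | zero =>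
    intro E _ _ _ v φ K h hv _ t ht
    refine contDiff_zero.2 ?_
    have : LipschitzWith (Real.exp (K * t)).toNNReal (φ t) := LipschitzWith.of_dist_le_mul
      fun x y => by
        rw [Real.coe_toNNReal _ (Real.exp_pos _).le, mul_comm]
        exact h.dist_le hv ht x y
    exact this.continuous
  | succ k ih =>
    intro E _ _ _ v φ K h hv hvs t ht
    have key : ∀ x₀, ∃ f' : E → E →L[ℝ] E, ContDiff ℝ k f' ∧
        ∀ x ∈ ball x₀ 1, HasFDerivAt (φ t) (f' x) x := by
      intro x₀
      obtain ⟨w, Ψ, C, hw, hC, hΨ, hD⟩ := h.exists_variational_flow hv hvs x₀ ht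
      refine ⟨fun x => (Ψ t (x, ContinuousLinearMap.id ℝ E)).2, ?_, fun x hx => ?_⟩
      · exact contDiff_snd.comp ((ih hΨ hC hw ht).comp (contDiff_id.prodMk contDiff_const))
      · exact h.hasFDerivAt_of_variational hv (hvs.of_le (by simp)) ht
          (D := fun s => (Ψ s (x, ContinuousLinearMap.id ℝ E)).2) (by simp [hΨ.zero]) (hD x hx)
    refine contDiff_succ_iff_hasFDerivAt.2 ⟨fderiv ℝ (φ t), ?_, fun x => ?_⟩
    · refine contDiff_iff_contDiffAt.2 fun x₀ => ?_
      obtain ⟨f', hf', hd⟩ := key x₀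
      refine hf'.contDiffAt.congr_of_eventuallyEq ?_
      filter_upwards [ball_mem_nhds x₀ one_pos] with x hx using (hd x hx).fderiv
    · obtain ⟨f', -, hd⟩ := key x
      exact (hd x (mem_ball_self one_pos)).differentiableAt.hasFDerivAt

theorem fderiv_zero_time {E : Type u} [NormedAddCommGroup E] [NormedSpace ℝ E] {v : E → E}
    {φ : ℝ → E → E} (h : IsGlobalFlow v φ) (x : E) :
    fderiv ℝ (φ 0) x = ContinuousLinearMap.id ℝ E := by
  have : φ 0 = id := funext h.zero
  rw [this, fderiv_id]

variable {E : Type u} [NormedAddCommGroup E] [NormedSpace ℝ E] [FiniteDimensional ℝ E]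
  {v : E → E} {φ : ℝ → E → E} {K : ℝ≥0}

/-- The time-`t` map of the flow of a smooth globally Lipschitz vector field is smooth. -/
theorem contDiff (h : IsGlobalFlow v φ) (hv : LipschitzWith K v) (hvs : ContDiff ℝ ∞ v) (t : ℝ) :
    ContDiff ℝ ∞ (φ t) := by
  refine contDiff_infty.2 fun k => ?_
  rcases le_total 0 t with ht | ht
  · exact contDiff_nat_of_nonneg k h hv hvs ht
  · have := contDiff_nat_of_nonneg k h.neg hv.neg hvs.neg (t := -t) (by linarith)
    simpa using this

/-- The derivative of the flow solves the variational equation. -/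
theorem hasDerivAt_fderiv (h : IsGlobalFlow v φ) (hv : LipschitzWith K v) (hvs : ContDiff ℝ ∞ v)
    (t : ℝ) (x : E) :
    HasDerivAt (fun s => fderiv ℝ (φ s) x)
      ((fderiv ℝ v (φ t x)).comp (fderiv ℝ (φ t) x)) t := by
  have pos : ∀ (t : ℝ) (x : E), 0 < t → HasDerivAt (fun s => fderiv ℝ (φ s) x)
      ((fderiv ℝ v (φ t x)).comp (fderiv ℝ (φ t) x)) t := by
    intro t x ht
    obtain ⟨w, Ψ, C, hw, hC, hΨ, hD⟩ :=
      h.exists_variational_flow hv hvs x (T := t + 1) (by linarith)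
    have hx := hD x (mem_ball_self one_pos)
    have heq : ∀ s ∈ Icc 0 (t + 1),
        fderiv ℝ (φ s) x = (Ψ s (x, ContinuousLinearMap.id ℝ E)).2 := fun s hs =>
      (h.hasFDerivAt_of_variational hv (hvs.of_le (by simp)) hs.1
        (D := fun s => (Ψ s (x, ContinuousLinearMap.id ℝ E)).2) (by simp [hΨ.zero])
        (fun r hr => hx r ⟨hr.1, hr.2.trans hs.2⟩)).fderiv
    have hd := hx t ⟨ht.le, by linarith⟩
    rw [← heq t ⟨ht.le, by linarith⟩] at hd
    refine hd.congr_of_eventuallyEq ?_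
    filter_upwards [Ioo_mem_nhds ht (lt_add_one t)] with s hs using heq s ⟨hs.1.le, hs.2.le⟩
  -- The case `t ≤ 0` is reduced to positive times by factoring `φ s = φ (s + a) ∘ φ (-a)`, whose
  -- second factor does not depend on `s`.
  set a : ℝ := |t| + 1
  have hdf : ∀ s, Differentiable ℝ (φ s) := fun s =>
    (h.contDiff hv hvs s).differentiable (by simp)
  have hsplit : ∀ s, fderiv ℝ (φ s) x
      = (fderiv ℝ (φ (s + a)) (φ (-a) x)).comp (fderiv ℝ (φ (-a)) x) := by
    intro s
    have : φ s = φ (s + a) ∘ φ (-a) := by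
      funext y
      rw [Function.comp_apply, ← h.map_add hv, add_neg_cancel_right]
    conv_lhs => rw [this]
    exact fderiv_comp x (hdf _ _) (hdf _ _)
  have h1 := (pos (t + a) (φ (-a) x) (by linarith [neg_abs_le t])).comp_add_const t a
  have h2 := h1.clm_comp (hasDerivAt_const t (fderiv ℝ (φ (-a)) x))
  simp only [← hsplit] at h2
  refine h2.congr_deriv ?_
  rw [← h.map_add hv, add_neg_cancel_right, hsplit t]
  ext
  simp

end IsGlobalFlow

end LipschitzFlow

/-! ### The weight function `ρ` -/

namespace JetTorus

namespace IsAdmissibleRho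

variable {n dy dz : ℕ} {ρy : (Fin n → ℝ) → ℝ}

theorem two_le_dy (hρ : IsAdmissibleRho ρy dy dz) : 2 ≤ dy := hρ.two_le.trans hρ.dz_le_dy

theorem dz_ne_zero (hρ : IsAdmissibleRho ρy dy dz) : dz ≠ 0 := by have := hρ.two_le; omega

theorem dy_ne_zero (hρ : IsAdmissibleRho ρy dy dz) : dy ≠ 0 := by have := hρ.two_le_dy; omega

theorem eq_rho (hρ : IsAdmissibleRho ρy dy dz) (y : Fin n → ℝ) : ρy y = rho ρy dz (y, 0) := by
  simp [rho, hρ.dz_ne_zero]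

theorem contDiff_y (hρ : IsAdmissibleRho ρy dy dz) : ContDiff ℝ ∞ ρy := by
  have : ρy = rho ρy dz ∘ fun y => (y, (0 : ℝ)) := funext hρ.eq_rho
  rw [this]
  exact hρ.smooth.comp (contDiff_id.prodMk contDiff_const)

theorem differentiable_y (hρ : IsAdmissibleRho ρy dy dz) : Differentiable ℝ ρy :=
  hρ.contDiff_y.differentiable (by simp)

theorem y_nonneg (hρ : IsAdmissibleRho ρy dy dz) (y : Fin n → ℝ) : 0 ≤ ρy y := by
  rw [hρ.eq_rho]
  exact hρ.nonneg _

theorem pow_z_nonneg (hρ : IsAdmissibleRho ρy dy dz) (z : ℝ) : 0 ≤ z ^ dz := hρ.even_dz.pow_nonneg z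

theorem y_zero (hρ : IsAdmissibleRho ρy dy dz) : ρy 0 = 0 := by
  have := hρ.homogeneous 0 0
  simpa [hρ.dy_ne_zero] using this

theorem rho_zero (hρ : IsAdmissibleRho ρy dy dz) : rho ρy dz 0 = 0 := by
  simp [rho, hρ.y_zero, hρ.dz_ne_zero]

theorem isCompact_sublevel (hρ : IsAdmissibleRho ρy dy dz) (r : ℝ) :
    IsCompact {w | rho ρy dz w ≤ r} := by
  have h1 : {w | rho ρy dz w ≤ r} = rho ρy dz ⁻¹' Icc 0 r := by
    ext w
    simp [hρ.nonneg w]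
  rw [h1]
  exact hρ.proper.isCompact_preimage isCompact_Icc

/-- If `ρy` vanished at some `y ≠ 0`, homogeneity would put the whole line through `y` in the zero
level, which is compact by properness. -/
theorem y_pos (hρ : IsAdmissibleRho ρy dy dz) {y : Fin n → ℝ} (hy : y ≠ 0) : 0 < ρy y := by
  refine (hρ.y_nonneg y).lt_of_ne fun h0 => ?_
  obtain ⟨R, hR⟩ := (hρ.isCompact_sublevel 0).isBounded.exists_norm_le
  have hy' : 0 < ‖y‖ := norm_pos_iff.2 hy
  set s : ℝ := (|R| + 1) / ‖y‖
  have hmem : (s • y, (0 : ℝ)) ∈ {w | rho ρy dz w ≤ 0} := by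
    simp only [mem_ofPred_eq, ← hρ.eq_rho, hρ.homogeneous, ← h0, mul_zero, le_refl]
  have h1 := hR _ hmem
  have h2 : ‖s • y‖ = |R| + 1 := by
    rw [norm_smul, Real.norm_of_nonneg (by positivity), div_mul_cancel₀ _ hy'.ne']
  have h3 := (norm_fst_le (s • y, (0 : ℝ))).trans h1
  simp only [h2] at h3
  linarith [le_abs_self R]

theorem rho_pos (hρ : IsAdmissibleRho ρy dy dz) {w : (Fin n → ℝ) × ℝ} (hw : w ≠ 0) :
    0 < rho ρy dz w := by
  unfold rho
  by_cases h : w.1 = 0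
  · have h2 : w.2 ≠ 0 := fun h2 => hw (Prod.ext h h2)
    have := hρ.even_dz.pow_pos h2
    linarith [hρ.y_nonneg w.1]
  · linarith [hρ.y_pos h, hρ.pow_z_nonneg w.2]

theorem rho_pos_iff (hρ : IsAdmissibleRho ρy dy dz) {w : (Fin n → ℝ) × ℝ} :
    0 < rho ρy dz w ↔ w ≠ 0 :=
  ⟨fun h h0 => by rw [h0, hρ.rho_zero] at h; exact lt_irrefl _ h, hρ.rho_pos⟩

theorem continuous_rho (hρ : IsAdmissibleRho ρy dy dz) : Continuous (rho ρy dz) :=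
  hρ.smooth.continuous

/-- On the compact set `{ρ ≤ 1, ‖w‖ ≥ η}` the function `ρ` attains a positive minimum. -/
theorem exists_norm_lt_of_rho_lt (hρ : IsAdmissibleRho ρy dy dz) {η : ℝ} (hη : 0 < η) :
    ∃ ε > 0, ∀ w, rho ρy dz w < ε → ‖w‖ < η := by
  have hS : IsCompact ({w | rho ρy dz w ≤ 1} ∩ {w | η ≤ ‖w‖}) :=
    (hρ.isCompact_sublevel 1).inter_right (isClosed_le continuous_const continuous_norm)
  rcases eq_empty_or_nonempty ({w | rho ρy dz w ≤ 1} ∩ {w | η ≤ ‖w‖}) with h | h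
  · refine ⟨1, one_pos, fun w hw => ?_⟩
    by_contra! hc
    exact (h ▸ (⟨hw.le, hc⟩ : w ∈ {w | rho ρy dz w ≤ 1} ∩ {w | η ≤ ‖w‖}) : w ∈ (∅ : Set _))
  · obtain ⟨w₀, hw₀, hmin⟩ := hS.exists_isMinOn h hρ.continuous_rho.continuousOn
    have hne : w₀ ≠ 0 := norm_pos_iff.1 (hη.trans_le hw₀.2)
    refine ⟨rho ρy dz w₀, hρ.rho_pos hne, fun w hw => ?_⟩
    by_contra! hc
    have hle : rho ρy dz w ≤ 1 := hw.le.trans hw₀.1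
    exact absurd (hmin ⟨hle, hc⟩) (not_le.2 hw)

theorem smul_fderiv (hρ : IsAdmissibleRho ρy dy dz) (s : ℝ) (y e : Fin n → ℝ) :
    s * fderiv ℝ ρy (s • y) e = s ^ dy * fderiv ℝ ρy y e := by
  have h1 : HasFDerivAt (fun x => ρy (s • x)) ((fderiv ℝ ρy (s • y)).comp
      (s • ContinuousLinearMap.id ℝ (Fin n → ℝ))) y :=
    (hρ.differentiable_y (s • y)).hasFDerivAt.comp y
      (s • ContinuousLinearMap.id ℝ (Fin n → ℝ)).hasFDerivAt
  have h2 : HasFDerivAt (fun x => ρy (s • x)) (s ^ dy • fderiv ℝ ρy y) y := by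
    simp only [hρ.homogeneous]
    exact (hρ.differentiable_y y).hasFDerivAt.const_mul _
  simpa using congrArg (fun L => L e) (h1.unique h2)

theorem fderiv_self (hρ : IsAdmissibleRho ρy dy dz) (y : Fin n → ℝ) :
    fderiv ℝ ρy y y = dy * ρy y := by
  have h0 : HasFDerivAt ρy (fderiv ℝ ρy y) ((1 : ℝ) • y) := by
    rw [one_smul]
    exact (hρ.differentiable_y y).hasFDerivAt
  have h1 : HasDerivAt (fun s : ℝ => ρy (s • y)) (fderiv ℝ ρy y ((1 : ℝ) • y)) 1 :=
    h0.comp_hasDerivAt 1 ((hasDerivAt_id (1 : ℝ)).smul_const y)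
  have h2 : HasDerivAt (fun s : ℝ => ρy (s • y)) (dy * (1 : ℝ) ^ (dy - 1) * ρy y) 1 := by
    simp only [hρ.homogeneous]
    exact (hasDerivAt_pow dy (1 : ℝ)).mul_const _
  simpa using h1.unique h2

/-- Euler's identity in coordinates. -/
theorem sum_mul_fderiv (hρ : IsAdmissibleRho ρy dy dz) (y : Fin n → ℝ) :
    ∑ j, y j * fderiv ℝ ρy y (Pi.single j 1) = dy * ρy y := by
  rw [← hρ.fderiv_self]
  have := LinearMap.pi_apply_eq_sum_univ (fderiv ℝ ρy y : (Fin n → ℝ) →ₗ[ℝ] ℝ) y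
  simp only [ContinuousLinearMap.coe_coe, smul_eq_mul] at this
  rw [this]
  congr! 3 with j
  ext i
  simp [Pi.single_apply, eq_comm]

/-- The gradient is homogeneous of degree `dy - 1`. Scaling `y` to the level `ρy = 1` reduces the
bound to the compact set `{ρy ≤ 1}`, on which the derivative is bounded by `C`. -/
theorem exists_abs_fderiv_le (hρ : IsAdmissibleRho ρy dy dz) :
    ∃ C, 0 ≤ C ∧ ∀ y (j : Fin n),
      |fderiv ℝ ρy y (Pi.single j 1)| ≤ C * ρy y ^ (1 - 1 / (dy : ℝ)) := by
  have hS : IsCompact {y : Fin n → ℝ | ρy y ≤ 1} := by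
    have h1 : {y : Fin n → ℝ | ρy y ≤ 1} ⊆ Prod.fst '' {w | rho ρy dz w ≤ 1} := fun y hy =>
      ⟨(y, 0), by simpa only [mem_ofPred_eq, ← hρ.eq_rho] using hy, rfl⟩
    exact ((hρ.isCompact_sublevel 1).image continuous_fst).of_isClosed_subset
      (isClosed_le hρ.contDiff_y.continuous continuous_const) h1
  obtain ⟨C, hC⟩ := hS.exists_bound_of_continuousOn
    ((hρ.contDiff_y.continuous_fderiv (by simp)).continuousOn)
  have hC0 : 0 ≤ C := (norm_nonneg _).trans (hC 0 (by simp [hρ.y_zero]))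
  have hCj : ∀ y, ρy y ≤ 1 → ∀ j, |fderiv ℝ ρy y (Pi.single j 1)| ≤ C := by
    intro y hy j
    have h1 := (fderiv ℝ ρy y).le_opNorm (Pi.single j 1)
    rw [Pi.norm_single, norm_one, mul_one] at h1
    exact h1.trans (hC y hy)
  have hdy : (2 : ℝ) ≤ dy := by exact_mod_cast hρ.two_le_dy
  refine ⟨C, hC0, fun y j => ?_⟩
  by_cases hy : y = 0
  -- At the origin there is nothing to scale; homogeneity with `s = 2` forces the gradient to vanish
  -- because `2 ^ dy ≠ 2`.
  · have h1 := hρ.smul_fderiv 2 y (Pi.single j 1)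
    rw [hy, smul_zero] at h1
    have h2 : (2 : ℝ) ^ 2 ≤ 2 ^ dy := pow_le_pow_right₀ (by norm_num) hρ.two_le_dy
    have h3 : fderiv ℝ ρy 0 (Pi.single j 1) = 0 := by
      have : (2 ^ dy - 2) * fderiv ℝ ρy 0 (Pi.single j 1) = 0 := by linarith
      rcases mul_eq_zero.1 this with h | h
      · nlinarith
      · exact h
    rw [hy, h3, abs_zero]
    exact mul_nonneg hC0 (Real.rpow_nonneg (hρ.y_nonneg _) _)
  · have hpos := hρ.y_pos hy
    set s : ℝ := ρy y ^ (1 / (dy : ℝ)) with hs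
    have hs0 : 0 < s := Real.rpow_pos_of_pos hpos _
    have hsd : s ^ dy = ρy y := by
      rw [hs, one_div, Real.rpow_inv_natCast_pow hpos.le hρ.dy_ne_zero]
    have h1 : ρy (s⁻¹ • y) = 1 := by
      rw [hρ.homogeneous, inv_pow, hsd, inv_mul_cancel₀ hpos.ne']
    have h2 := hρ.smul_fderiv s (s⁻¹ • y) (Pi.single j 1)
    rw [smul_smul, mul_inv_cancel₀ hs0.ne', one_smul, hsd] at h2
    have h3 : fderiv ℝ ρy y (Pi.single j 1)
        = ρy y ^ (1 - 1 / (dy : ℝ)) * fderiv ℝ ρy (s⁻¹ • y) (Pi.single j 1) := by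
      rw [Real.rpow_sub hpos, Real.rpow_one, ← hs, div_mul_eq_mul_div, eq_div_iff hs0.ne', ← h2]
      ring
    rw [h3, abs_mul, abs_of_nonneg (Real.rpow_nonneg hpos.le _), mul_comm]
    gcongr
    exact hCj _ h1.le j

/-- Combines `|z| ≤ ρ ^ (1 / dz)` with the gradient bound. The resulting power of `ρ` is the one
matched by the decay condition (iv). -/
theorem exists_abs_mul_fderiv_le (hρ : IsAdmissibleRho ρy dy dz) :
    ∃ C, 0 ≤ C ∧ ∀ (w : (Fin n → ℝ) × ℝ) (j : Fin n), w ≠ 0 →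
      |w.2 * fderiv ℝ ρy w.1 (Pi.single j 1)|
        ≤ C * (rho ρy dz w ^ (1 / (dz : ℝ) - 1 / (dy : ℝ)) * rho ρy dz w) := by
  obtain ⟨C, hC0, hC⟩ := hρ.exists_abs_fderiv_le
  refine ⟨C, hC0, fun w j hw => ?_⟩
  have hpos := hρ.rho_pos hw
  have hdy : (2 : ℝ) ≤ dy := by exact_mod_cast hρ.two_le_dy
  have hz : |w.2| ≤ rho ρy dz w ^ (1 / (dz : ℝ)) := by
    rw [← Real.pow_rpow_inv_natCast (abs_nonneg w.2) hρ.dz_ne_zero, one_div]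
    refine Real.rpow_le_rpow (by positivity) ?_ (by positivity)
    rw [hρ.even_dz.pow_abs, rho]
    linarith [hρ.y_nonneg w.1]
  have hy : |fderiv ℝ ρy w.1 (Pi.single j 1)| ≤ C * rho ρy dz w ^ (1 - 1 / (dy : ℝ)) := by
    refine (hC w.1 j).trans ?_
    gcongr
    · exact hρ.y_nonneg _
    · rw [sub_nonneg, div_le_one (by linarith)]
      linarith
    · rw [rho]
      linarith [hρ.pow_z_nonneg w.2]
  have hexp : rho ρy dz w ^ (1 / (dz : ℝ) - 1 / (dy : ℝ)) * rho ρy dz w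
      = rho ρy dz w ^ (1 / (dz : ℝ)) * rho ρy dz w ^ (1 - 1 / (dy : ℝ)) := by
    rw [← Real.rpow_add hpos, ← Real.rpow_add_one hpos.ne']
    ring_nf
  rw [hexp, abs_mul]
  calc |w.2| * |fderiv ℝ ρy w.1 (Pi.single j 1)|
      ≤ rho ρy dz w ^ (1 / (dz : ℝ)) * (C * rho ρy dz w ^ (1 - 1 / (dy : ℝ))) := by gcongr
    _ = _ := by ring

end IsAdmissibleRho

end JetTorus

/-! ### Radial profiles and their truncations -/

namespace JetTorus

/-- A smooth function with values in `[1, ∞)`, equal to the identity on `[2, ∞)`. -/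
def unitClamp (s : ℝ) : ℝ := 2 + ∫ r in (2 : ℝ)..s, Real.smoothTransition (r - 1)

theorem continuous_smoothTransition_sub_one :
    Continuous fun r : ℝ => Real.smoothTransition (r - 1) :=
  Real.smoothTransition.continuous.comp (continuous_id.sub continuous_const)

theorem hasDerivAt_unitClamp (s : ℝ) :
    HasDerivAt unitClamp (Real.smoothTransition (s - 1)) s :=
  (continuous_smoothTransition_sub_one.integral_hasStrictDerivAt 2 s).hasDerivAt.const_add 2

theorem contDiff_unitClamp : ContDiff ℝ ∞ unitClamp := by
  rw [contDiff_infty_iff_deriv]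
  refine ⟨fun s => (hasDerivAt_unitClamp s).differentiableAt, ?_⟩
  rw [funext fun s => (hasDerivAt_unitClamp s).deriv]
  exact Real.smoothTransition.contDiff.comp (contDiff_id.sub contDiff_const)

theorem unitClamp_of_two_le {s : ℝ} (hs : 2 ≤ s) : unitClamp s = s := by
  have : ∫ r in (2 : ℝ)..s, Real.smoothTransition (r - 1) = ∫ _ in (2 : ℝ)..s, (1 : ℝ) := by
    refine intervalIntegral.integral_congr fun r hr => ?_
    rw [uIcc_of_le hs] at hr
    exact Real.smoothTransition.one_of_one_le (by linarith [hr.1])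
  rw [unitClamp, this]
  simp

theorem monotone_unitClamp : Monotone unitClamp :=
  monotone_of_hasDerivAt_nonneg hasDerivAt_unitClamp fun _ => Real.smoothTransition.nonneg _

theorem le_unitClamp (s : ℝ) : s ≤ unitClamp s := by
  rcases le_total 2 s with h | h
  · exact (unitClamp_of_two_le h).ge
  · have hmono : Monotone fun r => r - unitClamp r :=
      monotone_of_hasDerivAt_nonneg (fun r => (hasDerivAt_id r).sub (hasDerivAt_unitClamp r))
        fun r => sub_nonneg.2 (Real.smoothTransition.le_one _)
    have := hmono h
    simp only [unitClamp_of_two_le le_rfl] at this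
    linarith

/-- The integrand vanishes to the left of `1`, so the function is constant there, with value
`unitClamp 1 ≥ 1`. -/
theorem one_le_unitClamp (s : ℝ) : 1 ≤ unitClamp s := by
  rcases le_total 1 s with h | h
  · exact h.trans (le_unitClamp s)
  · have : unitClamp s = unitClamp 1 := by
      have h1 : (∫ r in (2 : ℝ)..1, Real.smoothTransition (r - 1))
          + ∫ r in (1 : ℝ)..s, Real.smoothTransition (r - 1)
          = ∫ r in (2 : ℝ)..s, Real.smoothTransition (r - 1) :=
        intervalIntegral.integral_add_adjacent_intervals
          (continuous_smoothTransition_sub_one.intervalIntegrable _ _)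
          (continuous_smoothTransition_sub_one.intervalIntegrable _ _)
      have h2 : ∫ r in (1 : ℝ)..s, Real.smoothTransition (r - 1) = ∫ _ in (1 : ℝ)..s, (0 : ℝ) := by
        refine intervalIntegral.integral_congr fun r hr => ?_
        rw [uIcc_of_ge h] at hr
        exact Real.smoothTransition.zero_of_nonpos (by linarith [hr.2])
      rw [h2] at h1
      rw [unitClamp, unitClamp, ← h1]
      simp
    rw [this]
    exact le_unitClamp 1

/-- A smooth function with values in `[δ, ∞)`, equal to the identity on `[2 δ, ∞)`. -/
def clamp (δ r : ℝ) : ℝ := δ * unitClamp (r / δ)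

section clamp

variable {δ : ℝ}

theorem contDiff_clamp : ContDiff ℝ ∞ (clamp δ) :=
  contDiff_const.mul (contDiff_unitClamp.comp (contDiff_id.div_const δ))

theorem hasDerivAt_clamp (hδ : 0 < δ) (r : ℝ) :
    HasDerivAt (clamp δ) (Real.smoothTransition (r / δ - 1)) r := by
  have := ((hasDerivAt_unitClamp (r / δ)).comp r ((hasDerivAt_id r).div_const δ)).const_mul δ
  refine this.congr_deriv ?_
  field_simp

theorem le_clamp_self (hδ : 0 < δ) (r : ℝ) : δ ≤ clamp δ r :=
  le_mul_of_one_le_right hδ.le (one_le_unitClamp _)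

theorem clamp_pos (hδ : 0 < δ) (r : ℝ) : 0 < clamp δ r := hδ.trans_le (le_clamp_self hδ r)

theorem le_clamp (hδ : 0 < δ) (r : ℝ) : r ≤ clamp δ r := by
  have := mul_le_mul_of_nonneg_left (le_unitClamp (r / δ)) hδ.le
  rwa [mul_div_cancel₀ _ hδ.ne'] at this

theorem clamp_of_le (hδ : 0 < δ) {r : ℝ} (hr : 2 * δ ≤ r) : clamp δ r = r := by
  rw [clamp, unitClamp_of_two_le ((le_div_iff₀ hδ).2 hr), mul_div_cancel₀ _ hδ.ne']

theorem clamp_le_max (hδ : 0 < δ) (r : ℝ) : clamp δ r ≤ max r (2 * δ) := by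
  rcases le_total (2 * δ) r with h | h
  · rw [clamp_of_le hδ h]
    exact le_max_left _ _
  · refine le_max_of_le_right ?_
    rw [← clamp_of_le hδ (le_refl (2 * δ))]
    refine mul_le_mul_of_nonneg_left (monotone_unitClamp ?_) hδ.le
    gcongr

end clamp

/-- The radial profile `g r = F (-log r)` of the Hamiltonian `z F (-log ρ)`, after extending `F` by
zero, vanishing exactly for `r ≥ r₀`. -/
structure IsProfile (g : ℝ → ℝ) (r₀ : ℝ) (dy dz : ℕ) : Prop where
  smooth : ContDiffOn ℝ ∞ g (Ioi 0)
  nonpos : ∀ r, 0 < r → g r ≤ 0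
  deriv_nonneg : ∀ r, 0 < r → 0 ≤ deriv g r
  pos : 0 < r₀
  eq_zero_iff : ∀ r, 0 < r → (g r = 0 ↔ r₀ ≤ r)
  exists_clock : ∃ Θ : ℝ → ℝ, (∀ r ∈ Ioo 0 r₀, HasDerivAt Θ (1 / (r * g r)) r) ∧
    Tendsto Θ (𝓝[>] 0) atTop
  decay : Tendsto (fun r => r ^ (1 / (dz : ℝ) - 1 / (dy : ℝ)) * (r * deriv g r)) (𝓝[>] 0) (𝓝 0)
  log_deriv : Tendsto (fun r => r * deriv g r / g r) (𝓝[>] 0) (𝓝 0)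

namespace IsProfile

variable {g : ℝ → ℝ} {r₀ : ℝ} {dy dz : ℕ} {δ : ℝ}

theorem contDiffAt (hg : IsProfile g r₀ dy dz) {r : ℝ} (hr : 0 < r) : ContDiffAt ℝ ∞ g r :=
  hg.smooth.contDiffAt (Ioi_mem_nhds hr)

theorem hasDerivAt (hg : IsProfile g r₀ dy dz) {r : ℝ} (hr : 0 < r) :
    HasDerivAt g (deriv g r) r :=
  ((hg.contDiffAt hr).differentiableAt (by simp)).hasDerivAt

theorem monotoneOn (hg : IsProfile g r₀ dy dz) : MonotoneOn g (Ioi 0) := by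
  refine monotoneOn_of_deriv_nonneg (convex_Ioi 0) hg.smooth.continuousOn ?_ ?_
  · rw [interior_Ioi]
    exact hg.smooth.differentiableOn (by simp)
  · rw [interior_Ioi]
    exact hg.deriv_nonneg

theorem neg_of_lt (hg : IsProfile g r₀ dy dz) {r : ℝ} (hr : 0 < r) (hr₀ : r < r₀) : g r < 0 :=
  (hg.nonpos r hr).lt_of_ne fun h => absurd ((hg.eq_zero_iff r hr).1 h) (not_le.2 hr₀)

theorem contDiff_trunc (hg : IsProfile g r₀ dy dz) (hδ : 0 < δ) : ContDiff ℝ ∞ (g ∘ clamp δ) :=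
  contDiff_iff_contDiffAt.2 fun r =>
    (hg.contDiffAt (clamp_pos hδ r)).comp r contDiff_clamp.contDiffAt

theorem trunc_nonpos (hg : IsProfile g r₀ dy dz) (hδ : 0 < δ) (r : ℝ) : (g ∘ clamp δ) r ≤ 0 :=
  hg.nonpos _ (clamp_pos hδ r)

/-- Truncation only weakens the Hamiltonian, so estimates on how fast orbits approach the zero
section survive it. -/
theorem le_trunc (hg : IsProfile g r₀ dy dz) (hδ : 0 < δ) {r : ℝ} (hr : 0 < r) :
    g r ≤ (g ∘ clamp δ) r :=
  hg.monotoneOn hr (clamp_pos hδ r) (le_clamp hδ r)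

theorem trunc_eq_zero (hg : IsProfile g r₀ dy dz) (hδ : 0 < δ) {r : ℝ} (hr : r₀ ≤ r) :
    (g ∘ clamp δ) r = 0 :=
  (hg.eq_zero_iff _ (clamp_pos hδ r)).2 (hr.trans (le_clamp hδ r))

theorem trunc_eq (hδ : 0 < δ) {r : ℝ} (hr : 2 * δ ≤ r) : (g ∘ clamp δ) r = g r := by
  rw [Function.comp_apply, clamp_of_le hδ hr]

theorem deriv_trunc (hg : IsProfile g r₀ dy dz) (hδ : 0 < δ) (r : ℝ) :
    deriv (g ∘ clamp δ) r = deriv g (clamp δ r) * Real.smoothTransition (r / δ - 1) :=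
  ((hg.hasDerivAt (clamp_pos hδ r)).comp r (hasDerivAt_clamp hδ r)).deriv

theorem deriv_trunc_nonneg (hg : IsProfile g r₀ dy dz) (hδ : 0 < δ) (r : ℝ) :
    0 ≤ deriv (g ∘ clamp δ) r := by
  rw [hg.deriv_trunc hδ]
  exact mul_nonneg (hg.deriv_nonneg _ (clamp_pos hδ r)) (Real.smoothTransition.nonneg _)

/-- The clamp has slope at most `1` and lies above the identity. Bounds on `r g'(r)` near `0` thus
pass to every truncation, evaluated at the clamped radius. -/
theorem mul_deriv_trunc_le (hg : IsProfile g r₀ dy dz) (hδ : 0 < δ) (r : ℝ) :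
    r * deriv (g ∘ clamp δ) r ≤ clamp δ r * deriv g (clamp δ r) := by
  have h1 := hg.deriv_nonneg _ (clamp_pos hδ r)
  have h2 : deriv (g ∘ clamp δ) r ≤ deriv g (clamp δ r) := by
    rw [hg.deriv_trunc hδ]
    exact mul_le_of_le_one_right h1 (Real.smoothTransition.le_one _)
  exact mul_le_mul (le_clamp hδ r) h2 (hg.deriv_trunc_nonneg hδ r) (clamp_pos hδ r).le

end IsProfile

/-- The radial profile of `F`. -/
def profile (F : ℝ → ℝ) (r₀ r : ℝ) : ℝ := if r₀ ≤ r then 0 else F (-Real.log r)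

/-! ### From `F` to its radial profile -/

section profile

variable {F : ℝ → ℝ} {c u₀ : ℝ}

theorem neg_log_lt_neg_log {r : ℝ} (hr : 0 < r) (hrc : r < c) : -Real.log c < -Real.log r :=
  neg_lt_neg (Real.log_lt_log hr hrc)

theorem profile_eq (hF : ∀ u, -Real.log c < u → (F u = 0 ↔ u ≤ u₀)) {r : ℝ} (hr : 0 < r)
    (hrc : r < c) : profile F (Real.exp (-u₀)) r = F (-Real.log r) := by
  unfold profile
  split_ifs with h
  · refine ((hF _ (neg_log_lt_neg_log hr hrc)).2 ?_).symm
    have := (Real.le_log_iff_exp_le hr).2 h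
    linarith
  · rfl

theorem profile_eventuallyEq (hF : ∀ u, -Real.log c < u → (F u = 0 ↔ u ≤ u₀)) {r : ℝ}
    (hr : 0 < r) (hrc : r < c) :
    profile F (Real.exp (-u₀)) =ᶠ[𝓝 r] fun r => F (-Real.log r) := by
  filter_upwards [Ioo_mem_nhds hr hrc] with s hs using profile_eq hF hs.1 hs.2

/-- Substituting `u = -log r` gives `r g' = -F'` and `e^{(1/d_y - 1/d_z) u} = r^{1/d_z - 1/d_y}`, so
the conditions on `F` at infinity become conditions on `g` at `0`. On the overlap `[r₀, c)` both
formulas for `g` give zero, which makes `g` smooth. -/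
theorem IsAdmissibleF.exists_isProfile {dy dz : ℕ} (hc : 0 < c) (hF : IsAdmissibleF F c dy dz) :
    ∃ (g : ℝ → ℝ) (r₀ : ℝ), IsProfile g r₀ dy dz ∧ r₀ < c ∧
      (∀ r, 0 < r → r < c → g r = F (-Real.log r)) := by
  obtain ⟨u₀, hu₀, hF0, u₁, hu₁, hint⟩ := hF.exists_u0
  set r₀ := Real.exp (-u₀) with hr₀
  have hr₀c : r₀ < c := by
    rw [hr₀, ← Real.lt_log_iff_exp_lt hc]
    linarith
  have hr₀pos : 0 < r₀ := Real.exp_pos _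
  set g := profile F r₀ with hgdef
  have hev : ∀ {r}, 0 < r → r < c → g =ᶠ[𝓝 r] fun r => F (-Real.log r) := fun h h' =>
    profile_eventuallyEq hF0 h h'
  have hev0 : ∀ {r}, r₀ < r → g =ᶠ[𝓝 r] fun _ => 0 := by
    intro r h
    filter_upwards [Ioi_mem_nhds h] with s hs
    exact if_pos (le_of_lt hs)
  have hFat : ∀ {u}, -Real.log c < u → ContDiffAt ℝ ∞ F u := fun h =>
    hF.smooth.contDiffAt (Ioi_mem_nhds h)
  have hderiv : ∀ {r}, 0 < r → r < c → deriv g r = -(deriv F (-Real.log r) / r) := by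
    intro r hr hrc
    rw [(hev hr hrc).deriv_eq]
    have h1 : HasDerivAt F (deriv F (-Real.log r)) (-Real.log r) :=
      ((hFat (neg_log_lt_neg_log hr hrc)).differentiableAt (by simp)).hasDerivAt
    have h2 := h1.comp r (Real.hasDerivAt_log hr.ne').neg
    rw [show (fun r => F (-Real.log r)) = F ∘ (-Real.log) from rfl, h2.deriv]
    field_simp
  have hlogtop : Tendsto (fun r => -Real.log r) (𝓝[>] 0) atTop :=
    tendsto_neg_atBot_atTop.comp Real.tendsto_log_nhdsGT_zero
  have hsmall : ∀ᶠ r in 𝓝[>] (0 : ℝ), 0 < r ∧ r < c :=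
    eventually_of_mem (Ioo_mem_nhdsGT hc) fun r hr => hr
  refine ⟨g, r₀, ?_, hr₀c, fun r hr hrc => profile_eq hF0 hr hrc⟩
  refine ⟨?_, ?_, ?_, hr₀pos, ?_, ?_, ?_, ?_⟩
  · intro r hr
    refine ContDiffAt.contDiffWithinAt ?_
    rcases lt_or_ge r c with h | h
    · exact ((hFat (neg_log_lt_neg_log hr h)).comp r
        (Real.contDiffAt_log.2 (ne_of_gt hr)).neg).congr_of_eventuallyEq (hev hr h)
    · exact contDiffAt_const.congr_of_eventuallyEq (hev0 (hr₀c.trans_le h))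
  · intro r hr
    rcases lt_or_ge r c with h | h
    · rw [(hev hr h).eq_of_nhds]
      exact hF.nonpos _ (neg_log_lt_neg_log hr h)
    · rw [(hev0 (hr₀c.trans_le h)).eq_of_nhds]
  · intro r hr
    rcases lt_or_ge r c with h | h
    · rw [hderiv hr h, ← neg_div]
      exact div_nonneg (neg_nonneg.2 (hF.deriv_nonpos _ (neg_log_lt_neg_log hr h))) hr.le
    · rw [(hev0 (hr₀c.trans_le h)).deriv_eq]
      simp
  · intro r hr
    rcases lt_or_ge r c with h | h
    · rw [(hev hr h).eq_of_nhds, hF0 _ (neg_log_lt_neg_log hr h), hr₀,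
        ← Real.le_log_iff_exp_le hr]
      constructor <;> intro h <;> linarith
    · rw [(hev0 (hr₀c.trans_le h)).eq_of_nhds]
      simp [(hr₀c.trans_le h).le]
  -- The clock is the integral in (iii) with its sign reversed; the chain rule for `-log r` supplies
  -- the factor `1 / r`.
  · refine ⟨fun r => -∫ u in u₁..(-Real.log r), 1 / F u, ?_, ?_⟩
    · intro r hr
      have hrc : r < c := hr.2.trans hr₀c
      have hu : u₀ < -Real.log r := by
        have := (Real.log_lt_iff_lt_exp hr.1).2 hr.2
        linarith
      have hcont : ContinuousOn (fun u => 1 / F u) (Ioi u₀) := by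
        refine continuousOn_const.div
          (hF.smooth.continuousOn.mono (Ioi_subset_Ioi hu₀.le)) fun u hu => ?_
        rw [Ne, hF0 u (hu₀.trans hu)]
        exact not_le.2 hu
      have hii : IntervalIntegrable (fun u => 1 / F u) MeasureTheory.volume u₁ (-Real.log r) :=
        (hcont.mono fun u h => (lt_min hu₁ hu).trans_le h.1).intervalIntegrable
      have h1 := intervalIntegral.integral_hasDerivAt_right hii
        (hcont.stronglyMeasurableAtFilter isOpen_Ioi _ hu) (hcont.continuousAt (Ioi_mem_nhds hu))
      have h2 := (h1.comp r (Real.hasDerivAt_log hr.1.ne').neg).neg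
      refine h2.congr_deriv ?_
      rw [(hev hr.1 hrc).eq_of_nhds]
      field_simp
    · exact tendsto_neg_atBot_atTop.comp (hint.comp hlogtop)
  · have h1 := (hF.decay.comp hlogtop).neg
    rw [neg_zero] at h1
    refine h1.congr' ?_
    filter_upwards [hsmall] with r hr
    rw [hderiv hr.1 hr.2, Real.rpow_def_of_pos hr.1]
    simp only [Function.comp_apply]
    rw [show (1 / (dy : ℝ) - 1 / (dz : ℝ)) * -Real.log r
      = Real.log r * (1 / (dz : ℝ) - 1 / (dy : ℝ)) by ring]
    have := hr.1.ne'
    field_simp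
  · have h1 := (hF.log_deriv.comp hlogtop).neg
    rw [neg_zero] at h1
    refine h1.congr' ?_
    filter_upwards [hsmall] with r hr
    rw [hderiv hr.1 hr.2, (hev hr.1 hr.2).eq_of_nhds]
    simp only [Function.comp_apply]
    have := hr.1.ne'
    field_simp

end profile

end JetTorus

/-! ### The Hamiltonian vector field of `z g(ρ)` -/

namespace JetTorus

open LipschitzFlow
open scoped NNReal

variable {n : ℕ}

/-- The Hamiltonian `z g(ρ(y, z))`. -/
def radialHam (g : ℝ → ℝ) (ρ : (Fin n → ℝ) × ℝ → ℝ) (p : Jet n) : ℝ := p.2.2 * g (ρ p.2)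

/-- The derivative of `z g(ρ)` along the Reeb field `∂_z`. -/
def reebDeriv (g : ℝ → ℝ) (ρy : (Fin n → ℝ) → ℝ) (dz : ℕ) (w : (Fin n → ℝ) × ℝ) : ℝ :=
  g (rho ρy dz w) + deriv g (rho ρy dz w) * (dz * w.2 ^ dz)

/-- The contact Hamiltonian vector field of `z g(ρ)`. -/
def field (g : ℝ → ℝ) (ρy : (Fin n → ℝ) → ℝ) (dy dz : ℕ) (p : Cover n) : Cover n :=
  (fun j => -(deriv g (rho ρy dz p.2) * (p.2.2 * fderiv ℝ ρy p.2.1 (Pi.single j 1))),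
   fun j => p.2.1 j * reebDeriv g ρy dz p.2,
   p.2.2 * (g (rho ρy dz p.2) - deriv g (rho ρy dz p.2) * (dy * ρy p.2.1)))

@[simp]
theorem proj_snd (p : Cover n) : (proj p).2 = p.2 := rfl

theorem hamVF_congr {H H' : Jet n → ℝ} {p : Cover n}
    (h : (fun q => H (proj q)) =ᶠ[𝓝 p] fun q => H' (proj q)) : hamVF H p = hamVF H' p := by
  have h1 : H (proj p) = H' (proj p) := h.eq_of_nhds
  simp only [hamVF, h.fderiv_eq, h1]

theorem field_congr {g g' : ℝ → ℝ} {ρy : (Fin n → ℝ) → ℝ} {dy dz : ℕ} {p : Cover n}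
    (h : g =ᶠ[𝓝 (rho ρy dz p.2)] g') : field g ρy dy dz p = field g' ρy dy dz p := by
  simp only [field, reebDeriv, h.deriv_eq, h.eq_of_nhds]

section field

variable {ρy : (Fin n → ℝ) → ℝ} {dy dz : ℕ} {g : ℝ → ℝ}

theorem IsAdmissibleRho.hasFDerivAt_rho (hρ : IsAdmissibleRho ρy dy dz) (w : (Fin n → ℝ) × ℝ) :
    HasFDerivAt (rho ρy dz) ((fderiv ℝ ρy w.1).comp (ContinuousLinearMap.fst ℝ _ ℝ)
      + (dz * w.2 ^ (dz - 1)) • ContinuousLinearMap.snd ℝ (Fin n → ℝ) ℝ) w := by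
  have h1 : HasFDerivAt (fun w : (Fin n → ℝ) × ℝ => ρy w.1)
      ((fderiv ℝ ρy w.1).comp (ContinuousLinearMap.fst ℝ _ ℝ)) w :=
    (hρ.differentiable_y w.1).hasFDerivAt.comp w hasFDerivAt_fst
  have h2 : HasFDerivAt (fun w : (Fin n → ℝ) × ℝ => w.2 ^ dz)
      ((dz * w.2 ^ (dz - 1)) • ContinuousLinearMap.snd ℝ (Fin n → ℝ) ℝ) w :=
    (hasDerivAt_pow dz w.2).comp_hasFDerivAt w hasFDerivAt_snd
  exact h1.add h2

theorem hasFDerivAt_radialHam (hρ : IsAdmissibleRho ρy dy dz) {p : Cover n}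
    (hg : DifferentiableAt ℝ g (rho ρy dz p.2)) :
    ∃ L : Cover n →L[ℝ] ℝ, HasFDerivAt (fun q => radialHam g (rho ρy dz) (proj q)) L p ∧
      ∀ v, L v = v.2.2 * g (rho ρy dz p.2) + p.2.2 * (deriv g (rho ρy dz p.2) *
        (fderiv ℝ ρy p.2.1 v.2.1 + dz * p.2.2 ^ (dz - 1) * v.2.2)) := by
  have h1 : HasFDerivAt (fun q : Cover n => q.2.2)
      ((ContinuousLinearMap.snd ℝ (Fin n → ℝ) ℝ).comp (ContinuousLinearMap.snd ℝ (Fin n → ℝ) _)) p :=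
    ((ContinuousLinearMap.snd ℝ (Fin n → ℝ) ℝ).comp
      (ContinuousLinearMap.snd ℝ (Fin n → ℝ) _)).hasFDerivAt
  have h2 := (hρ.hasFDerivAt_rho p.2).comp p hasFDerivAt_snd
  have h3 := hg.hasDerivAt.comp_hasFDerivAt p h2
  refine ⟨_, h1.mul h3, fun v => ?_⟩
  simp
  ring

theorem IsAdmissibleRho.mul_pow_sub_one (hρ : IsAdmissibleRho ρy dy dz) (z : ℝ) :
    z * z ^ (dz - 1) = z ^ dz := _root_.mul_pow_sub_one hρ.dz_ne_zero z

theorem hamVF_radialHam (hρ : IsAdmissibleRho ρy dy dz) {p : Cover n}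
    (hg : DifferentiableAt ℝ g (rho ρy dz p.2)) :
    hamVF (radialHam g (rho ρy dz)) p = field g ρy dy dz p := by
  obtain ⟨L, hL, hLv⟩ := hasFDerivAt_radialHam hρ hg
  simp only [hamVF, hL.fderiv, hLv, field]
  refine Prod.ext ?_ (Prod.ext ?_ ?_)
  · funext j
    simp
    ring
  · funext j
    simp only [map_zero, reebDeriv, ← hρ.mul_pow_sub_one]
    ring
  · have : ∀ j, p.2.1 j * ((0 : ℝ) * g (rho ρy dz p.2) + p.2.2 * (deriv g (rho ρy dz p.2) *
        (fderiv ℝ ρy p.2.1 (Pi.single j 1) + dz * p.2.2 ^ (dz - 1) * 0)))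
        = (p.2.2 * deriv g (rho ρy dz p.2)) *
          (p.2.1 j * fderiv ℝ ρy p.2.1 (Pi.single j 1)) := fun j => by ring
    simp only [this, ← Finset.mul_sum, hρ.sum_mul_fderiv, radialHam, proj]
    ring

theorem fderiv_radialHam_reeb (hρ : IsAdmissibleRho ρy dy dz) {p : Cover n}
    (hg : DifferentiableAt ℝ g (rho ρy dz p.2)) :
    fderiv ℝ (fun q => radialHam g (rho ρy dz) (proj q)) p (0, 0, 1) = reebDeriv g ρy dz p.2 := by
  obtain ⟨L, hL, hLv⟩ := hasFDerivAt_radialHam hρ hg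
  rw [hL.fderiv, hLv, reebDeriv, ← hρ.mul_pow_sub_one]
  simp
  ring

theorem contDiff_reebDeriv (hρ : IsAdmissibleRho ρy dy dz) (hg : ContDiff ℝ ∞ g) :
    ContDiff ℝ ∞ (reebDeriv g ρy dz) := by
  have hg' : ContDiff ℝ ∞ (deriv g) := (contDiff_infty_iff_deriv.1 hg).2
  exact (hg.comp hρ.smooth).add
    ((hg'.comp hρ.smooth).mul (contDiff_const.mul (contDiff_snd.pow dz)))

theorem contDiff_field (hρ : IsAdmissibleRho ρy dy dz) (hg : ContDiff ℝ ∞ g) :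
    ContDiff ℝ ∞ (field g ρy dy dz) := by
  have hg' : ContDiff ℝ ∞ (deriv g) := (contDiff_infty_iff_deriv.1 hg).2
  have hr : ContDiff ℝ ∞ fun p : Cover n => rho ρy dz p.2 := hρ.smooth.comp contDiff_snd
  have hy : ContDiff ℝ ∞ fun p : Cover n => p.2.1 := contDiff_fst.comp contDiff_snd
  have hz : ContDiff ℝ ∞ fun p : Cover n => p.2.2 := contDiff_snd.comp contDiff_snd
  refine ContDiff.prodMk (contDiff_pi.2 fun j => ?_)
    (ContDiff.prodMk (contDiff_pi.2 fun j => ?_) ?_)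
  · have h1 : ContDiff ℝ ∞ fun p : Cover n => fderiv ℝ ρy p.2.1 (Pi.single j 1) :=
      ((hρ.contDiff_y.fderiv_right (m := ∞) (by simp)).comp hy).clm_apply contDiff_const
    exact ((hg'.comp hr).mul (hz.mul h1)).neg
  · exact (contDiff_pi.1 hy j).mul ((contDiff_reebDeriv hρ hg).comp contDiff_snd)
  · exact hz.mul ((hg.comp hr).sub ((hg'.comp hr).mul
      (contDiff_const.mul (hρ.contDiff_y.comp hy))))

theorem field_eq_zero_of_eventuallyEq {p : Cover n} (h : g =ᶠ[𝓝 (rho ρy dz p.2)] fun _ => 0) :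
    field g ρy dy dz p = 0 := by
  simp only [field, reebDeriv, h.deriv_eq, h.eq_of_nhds, deriv_const]
  ext <;> simp

/-- The field is not compactly supported on the cover, but it does not depend on `x` and has compact
support in `(y, z)`. -/
theorem exists_lipschitzWith_field (hρ : IsAdmissibleRho ρy dy dz) (hg : ContDiff ℝ ∞ g) {r₀ : ℝ}
    (hg0 : ∀ r, r₀ ≤ r → g r = 0) : ∃ K : ℝ≥0, LipschitzWith K (field g ρy dy dz) := by
  set f : (Fin n → ℝ) × ℝ → Cover n := fun w => field g ρy dy dz (0, w) with hf
  have hfs : ContDiff ℝ ∞ f := (contDiff_field hρ hg).comp (contDiff_const.prodMk contDiff_id)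
  have hfc : HasCompactSupport f := by
    refine HasCompactSupport.intro (hρ.isCompact_sublevel r₀) fun w hw => ?_
    refine field_eq_zero_of_eventuallyEq ?_
    filter_upwards [Ioi_mem_nhds (not_le.1 hw)] with r hr using hg0 r (le_of_lt hr)
  obtain ⟨C, hC⟩ := hfs.lipschitzWith_of_hasCompactSupport hfc (by simp)
  refine ⟨C * 1, ?_⟩
  have : field g ρy dy dz = f ∘ Prod.snd := rfl
  rw [this]
  exact hC.comp LipschitzWith.prod_snd

/-- The extra sum appears because the coefficients of `α` depend on `y`, which moves along the
curve. -/
theorem hasDerivAt_alpha {q ξ : ℝ → Cover n} {q' ξ' : Cover n} {t : ℝ} (hq : HasDerivAt q q' t)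
    (hξ : HasDerivAt ξ ξ' t) :
    HasDerivAt (fun s => alpha (q s) (ξ s))
      (alpha (q t) ξ' - ∑ j, q'.2.1 j * (ξ t).1 j) t := by
  simp only [alpha_apply]
  have hx := hasDerivAt_pi.1 ((ContinuousLinearMap.fst ℝ (Fin n → ℝ)
    ((Fin n → ℝ) × ℝ)).hasFDerivAt.comp_hasDerivAt t hξ)
  have hz := ((ContinuousLinearMap.snd ℝ (Fin n → ℝ) ℝ).comp
    (ContinuousLinearMap.snd ℝ (Fin n → ℝ) _)).hasFDerivAt.comp_hasDerivAt t hξ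
  have hy := hasDerivAt_pi.1 (((ContinuousLinearMap.fst ℝ (Fin n → ℝ) ℝ).comp
    (ContinuousLinearMap.snd ℝ (Fin n → ℝ) _)).hasFDerivAt.comp_hasDerivAt t hq)
  have hs := HasDerivAt.fun_sum fun j (_ : j ∈ Finset.univ) => (hy j).mul (hx j)
  refine (hz.sub hs).congr_deriv ?_
  simp only [Finset.sum_add_distrib]
  simp
  ring

theorem eq_exp_integral_mul {a h : ℝ → ℝ} (hh : Continuous h)
    (ha : ∀ t, HasDerivAt a (h t * a t) t) (t : ℝ) :
    a t = Real.exp (∫ s in (0 : ℝ)..t, h s) * a 0 := by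
  have hI : ∀ t, HasDerivAt (fun t => ∫ s in (0 : ℝ)..t, h s) (h t) t := fun t =>
    (hh.integral_hasStrictDerivAt 0 t).hasDerivAt
  have hb : ∀ t, HasDerivAt (fun t => Real.exp (-∫ s in (0 : ℝ)..t, h s) * a t) 0 t := fun t => by
    refine ((hI t).fun_neg.exp.mul (ha t)).congr_deriv ?_
    ring
  have := is_const_of_deriv_eq_zero (fun t => (hb t).differentiableAt) (fun t => (hb t).deriv) t 0
  simp only [intervalIntegral.integral_same, neg_zero, Real.exp_zero, one_mul] at this
  rw [← this, ← mul_assoc, ← Real.exp_add]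
  simp

variable {φ : ℝ → Cover n → Cover n} {K : ℝ≥0}

/-- The flow of the Hamiltonian vector field rescales the contact form. -/
theorem alpha_fderiv_flow (hρ : IsAdmissibleRho ρy dy dz) (hg : ContDiff ℝ ∞ g)
    (hK : LipschitzWith K (field g ρy dy dz)) (hφ : IsGlobalFlow (field g ρy dy dz) φ)
    (t : ℝ) (p v : Cover n) :
    alpha (φ t p) (fderiv ℝ (φ t) p v)
      = Real.exp (∫ s in (0 : ℝ)..t, reebDeriv g ρy dz (φ s p).2) * alpha p v := by
  set f := field g ρy dy dz with hf
  have hfs : ContDiff ℝ ∞ f := contDiff_field hρ hg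
  have hgd : Differentiable ℝ g := hg.differentiable (by simp)
  set H : Cover n → ℝ := fun q => radialHam g (rho ρy dz) (proj q) with hH
  have hchar : ∀ q, alpha q (f q) = H q ∧ ∀ ξ : Cover n, dAlpha (f q) ξ =
      fderiv ℝ H q (0, 0, 1) * alpha q ξ - fderiv ℝ H q ξ := fun q =>
    (hamVF_unique (radialHam g (rho ρy dz)) q (f q)).1 (hamVF_radialHam hρ (hgd _)).symm
  -- This is the identity `α(X_H) = H` differentiated in the direction `ξ`.
  have hdH : ∀ q ξ : Cover n, fderiv ℝ H q ξ
      = alpha q (fderiv ℝ f q ξ) - ∑ j, ξ.2.1 j * (f q).1 j := by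
    intro q ξ
    obtain ⟨L, hL, -⟩ := hasFDerivAt_radialHam hρ (hgd (rho ρy dz q.2)) (p := q)
    have hline : HasDerivAt (fun s : ℝ => q + s • ξ) ξ 0 := by
      simpa using ((hasDerivAt_id (0 : ℝ)).smul_const ξ).const_add q
    have hq0 : q + (0 : ℝ) • ξ = q := by simp
    have h1 : HasDerivAt (fun s : ℝ => H (q + s • ξ)) (fderiv ℝ H q ξ) 0 := by
      have : HasFDerivAt H (fderiv ℝ H q) (q + (0 : ℝ) • ξ) := by
        rw [hq0]; exact hL.differentiableAt.hasFDerivAt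
      exact this.comp_hasDerivAt 0 hline
    have h2 : HasDerivAt (fun s : ℝ => f (q + s • ξ)) (fderiv ℝ f q ξ) 0 := by
      have : HasFDerivAt f (fderiv ℝ f q) (q + (0 : ℝ) • ξ) := by
        rw [hq0]; exact (hfs.differentiable (by simp) q).hasFDerivAt
      exact this.comp_hasDerivAt 0 hline
    have h3 := hasDerivAt_alpha hline h2
    simp only [fun q => (hchar q).1, hq0] at h3
    exact h1.unique h3
  have hcont : Continuous fun s => reebDeriv g ρy dz (φ s p).2 :=
    (contDiff_reebDeriv hρ hg).continuous.comp (hφ.continuous_curve p).snd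
  -- Cartan's formula in coordinates: `L_X α = d(α(X)) + ι_X dα = dH + (H_z α - dH) = H_z α`.
  have hode : ∀ t, HasDerivAt (fun s => alpha (φ s p) (fderiv ℝ (φ s) p v))
      (reebDeriv g ρy dz (φ t p).2 * alpha (φ t p) (fderiv ℝ (φ t) p v)) t := by
    intro t
    have h1 : HasDerivAt (fun s => fderiv ℝ (φ s) p v)
        (fderiv ℝ f (φ t p) (fderiv ℝ (φ t) p v)) t := by
      simpa using (hφ.hasDerivAt_fderiv hK hfs t p).clm_apply (hasDerivAt_const t v)
    refine (hasDerivAt_alpha (hφ.deriv p t) h1).congr_deriv ?_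
    set ξ := fderiv ℝ (φ t) p v
    have h2 := hdH (φ t p) ξ
    have h3 := (hchar (φ t p)).2 ξ
    rw [fderiv_radialHam_reeb hρ (hgd _), dAlpha, Finset.sum_sub_distrib] at h3
    have h4 : ∑ j, ξ.2.1 j * (f (φ t p)).1 j = ∑ j, (f (φ t p)).1 j * ξ.2.1 j :=
      Finset.sum_congr rfl fun j _ => mul_comm _ _
    linarith
  have := eq_exp_integral_mul hcont hode t
  rw [this, hφ.zero, hφ.fderiv_zero_time]
  simp

/-- By Euler's identity the `y` part contributes `dy ρ_y (g + g' dz z^dz)` and the `z` part `dz z^dz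
(g - g' dy ρ_y)`; the mixed terms cancel. -/
theorem hasDerivAt_rho_flow (hρ : IsAdmissibleRho ρy dy dz)
    {γ : ℝ → Cover n} {t : ℝ} (hγ : HasDerivAt γ (field g ρy dy dz (γ t)) t) :
    HasDerivAt (fun s => rho ρy dz (γ s).2) (g (rho ρy dz (γ t).2) *
      (dy * ρy (γ t).2.1 + dz * (γ t).2.2 ^ dz)) t := by
  have h1 := (hρ.hasFDerivAt_rho (γ t).2).comp_hasDerivAt t
    ((ContinuousLinearMap.snd ℝ (Fin n → ℝ) _).hasFDerivAt.comp_hasDerivAt t hγ)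
  refine h1.congr_deriv ?_
  have h2 : (field g ρy dy dz (γ t)).2.1 = reebDeriv g ρy dz (γ t).2 • (γ t).2.1 := by
    funext j
    simp [field, mul_comm]
  simp only [ContinuousLinearMap.coe_snd', _root_.add_apply,
    ContinuousLinearMap.comp_apply, ContinuousLinearMap.coe_fst', _root_.smul_apply,
    h2, map_smul, smul_eq_mul, hρ.fderiv_self]
  simp only [field, reebDeriv, ← hρ.mul_pow_sub_one]
  ring

theorem flow_add_translate (hK : LipschitzWith K (field g ρy dy dz))
    (hφ : IsGlobalFlow (field g ρy dy dz) φ) (t : ℝ) (p : Cover n) (a : Fin n → ℝ) :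
    φ t (p.1 + a, p.2) = ((φ t p).1 + a, (φ t p).2) := by
  have := hφ.eq_of_hasDerivAt hK (γ := fun s => φ s p + (a, 0)) (fun s => by
    have h1 := (hφ.deriv p s).add_const ((a, 0) : Cover n)
    have h2 : field g ρy dy dz (φ s p + (a, 0)) = field g ρy dy dz (φ s p) := by
      simp [field]
    rwa [h2]) t
  rw [hφ.zero] at this
  have h3 : p + ((a, 0) : Cover n) = (p.1 + a, p.2) := by ext <;> simp
  rw [← h3, ← this]
  ext <;> simp

theorem flow_eq_self_of_snd_eq_zero
    (hK : LipschitzWith K (field g ρy dy dz)) (hφ : IsGlobalFlow (field g ρy dy dz) φ)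
    {p : Cover n} (hp : p.2 = 0) (t : ℝ) : φ t p = p := by
  refine hφ.eq_self_of_eq_zero hK ?_ t
  ext <;> simp [field, hp]

end field

end JetTorus

/-! ### Truncated Hamiltonian flows -/

namespace JetTorus

open LipschitzFlow
open scoped NNReal

variable {n : ℕ}

/-- The flows `φ m` of the Hamiltonians `z g(clamp (δ m) ρ)`, with `δ m → 0`. -/
structure IsTruncatedFlow (g : ℝ → ℝ) (r₀ : ℝ) (ρy : (Fin n → ℝ) → ℝ) (dy dz : ℕ) (δ : ℕ → ℝ)
    (φ : ℕ → ℝ → Cover n → Cover n) : Prop where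
  rho : IsAdmissibleRho ρy dy dz
  profile : IsProfile g r₀ dy dz
  pos : ∀ m, 0 < δ m
  tendsto : Tendsto δ atTop (𝓝 0)
  flow : ∀ m, IsGlobalFlow (field (g ∘ clamp (δ m)) ρy dy dz) (φ m)

theorem exists_isTruncatedFlow {ρy : (Fin n → ℝ) → ℝ} {dy dz : ℕ} {g : ℝ → ℝ} {r₀ : ℝ}
    (hρ : IsAdmissibleRho ρy dy dz) (hg : IsProfile g r₀ dy dz) :
    ∃ δ φ, IsTruncatedFlow (n := n) g r₀ ρy dy dz δ φ := by
  have hpos : ∀ m : ℕ, 0 < 1 / ((m : ℝ) + 1) := fun m => by positivity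
  have : ∀ m : ℕ, ∃ φ, IsGlobalFlow (field (g ∘ clamp (1 / ((m : ℝ) + 1))) ρy dy dz) φ := by
    intro m
    have hs := hg.contDiff_trunc (hpos m)
    obtain ⟨K, hK⟩ := exists_lipschitzWith_field hρ hs fun r hr => hg.trunc_eq_zero (hpos m) hr
    exact exists_isGlobalFlow ((contDiff_field hρ hs).of_le (by simp)) hK
  choose φ hφ using this
  exact ⟨fun m => 1 / ((m : ℝ) + 1), φ, hρ, hg, hpos, tendsto_one_div_add_atTop_nhds_zero_nat, hφ⟩

namespace IsTruncatedFlow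

variable {g : ℝ → ℝ} {r₀ : ℝ} {ρy : (Fin n → ℝ) → ℝ} {dy dz : ℕ} {δ : ℕ → ℝ}
  {φ : ℕ → ℝ → Cover n → Cover n}

theorem contDiff_trunc (h : IsTruncatedFlow g r₀ ρy dy dz δ φ) (m : ℕ) :
    ContDiff ℝ ∞ (g ∘ clamp (δ m)) := h.profile.contDiff_trunc (h.pos m)

theorem contDiff_field (h : IsTruncatedFlow g r₀ ρy dy dz δ φ) (m : ℕ) :
    ContDiff ℝ ∞ (field (g ∘ clamp (δ m)) ρy dy dz) :=
  JetTorus.contDiff_field h.rho (h.contDiff_trunc m)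

theorem exists_lipschitz (h : IsTruncatedFlow g r₀ ρy dy dz δ φ) (m : ℕ) :
    ∃ K : ℝ≥0, LipschitzWith K (field (g ∘ clamp (δ m)) ρy dy dz) :=
  exists_lipschitzWith_field h.rho (h.contDiff_trunc m)
    fun _ hr => h.profile.trunc_eq_zero (h.pos m) hr

theorem contDiff (h : IsTruncatedFlow g r₀ ρy dy dz δ φ) (m : ℕ) (t : ℝ) :
    ContDiff ℝ ∞ (φ m t) :=
  let ⟨_, hK⟩ := h.exists_lipschitz m
  (h.flow m).contDiff hK (h.contDiff_field m) t

theorem neg_comp (h : IsTruncatedFlow g r₀ ρy dy dz δ φ) (m : ℕ) (t : ℝ) (p : Cover n) :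
    φ m (-t) (φ m t p) = p :=
  let ⟨_, hK⟩ := h.exists_lipschitz m
  (h.flow m).neg_comp hK t p

theorem comp_neg (h : IsTruncatedFlow g r₀ ρy dy dz δ φ) (m : ℕ) (t : ℝ) (p : Cover n) :
    φ m t (φ m (-t) p) = p :=
  let ⟨_, hK⟩ := h.exists_lipschitz m
  (h.flow m).comp_neg hK t p

theorem add_translate (h : IsTruncatedFlow g r₀ ρy dy dz δ φ) (m : ℕ) (t : ℝ) (p : Cover n)
    (a : Fin n → ℝ) : φ m t (p.1 + a, p.2) = ((φ m t p).1 + a, (φ m t p).2) :=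
  let ⟨_, hK⟩ := h.exists_lipschitz m
  flow_add_translate hK (h.flow m) t p a

theorem eq_self (h : IsTruncatedFlow g r₀ ρy dy dz δ φ) (m : ℕ) (t : ℝ) {p : Cover n}
    (hp : p.2 = 0) : φ m t p = p :=
  let ⟨_, hK⟩ := h.exists_lipschitz m
  flow_eq_self_of_snd_eq_zero hK (h.flow m) hp t

theorem eq_self_of_le (h : IsTruncatedFlow g r₀ ρy dy dz δ φ) (m : ℕ) (t : ℝ) {p : Cover n}
    (hp : r₀ ≤ JetTorus.rho ρy dz p.2) : φ m t p = p := by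
  obtain ⟨K, hK⟩ := h.exists_lipschitz m
  refine (h.flow m).eq_self_of_eq_zero hK ?_ t
  have h0 : (g ∘ clamp (δ m)) (JetTorus.rho ρy dz p.2) = 0 := h.profile.trunc_eq_zero (h.pos m) hp
  -- This includes the boundary value `ρ = r₀`, where the profile need not vanish on a
  -- neighbourhood; being nonpositive, it has a maximum wherever it is zero.
  have h1 : deriv (g ∘ clamp (δ m)) (JetTorus.rho ρy dz p.2) = 0 := by
    refine IsLocalMax.deriv_eq_zero (Eventually.of_forall fun r => ?_)
    rw [h0]
    exact h.profile.trunc_nonpos (h.pos m) r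
  simp only [field, reebDeriv, h0, h1]
  ext <;> simp

theorem snd_ne_zero (h : IsTruncatedFlow g r₀ ρy dy dz δ φ) (m : ℕ) (t : ℝ) {p : Cover n}
    (hp : p.2 ≠ 0) : (φ m t p).2 ≠ 0 := by
  intro h0
  have h1 := h.eq_self m (-t) h0
  rw [h.neg_comp] at h1
  exact hp (h1 ▸ h0)

theorem antitone_rho (h : IsTruncatedFlow g r₀ ρy dy dz δ φ) (m : ℕ) (p : Cover n) :
    Antitone fun t => JetTorus.rho ρy dz (φ m t p).2 := by
  refine antitone_of_hasDerivAt_nonpos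
    (fun t => hasDerivAt_rho_flow h.rho ((h.flow m).deriv p t)) fun t => ?_
  refine mul_nonpos_of_nonpos_of_nonneg (h.profile.trunc_nonpos (h.pos m) _) ?_
  have h1 := h.rho.y_nonneg (φ m t p).2.1
  have h2 := h.rho.pow_z_nonneg (φ m t p).2.2
  positivity

theorem rho_le (h : IsTruncatedFlow g r₀ ρy dy dz δ φ) (m : ℕ) (p : Cover n) {t : ℝ}
    (ht : 0 ≤ t) : JetTorus.rho ρy dz (φ m t p).2 ≤ JetTorus.rho ρy dz p.2 := by
  have := h.antitone_rho m p ht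
  simpa only [(h.flow m).zero] using this

/-- The rate of `Θ(ρ)` is the quotient of the truncated by the true profile, which is at most `1`,
times `(dy ρ_y + dz z^dz) / ρ`, which is at most `dy` since `dz ≤ dy`. The bound does not involve
`m`. -/
theorem clock_le (h : IsTruncatedFlow g r₀ ρy dy dz δ φ) {Θ : ℝ → ℝ}
    (hΘ : ∀ r ∈ Ioo 0 r₀, HasDerivAt Θ (1 / (r * g r)) r) (m : ℕ) {p : Cover n} (hp : p.2 ≠ 0)
    (hpr : JetTorus.rho ρy dz p.2 < r₀) {t : ℝ} (ht : 0 ≤ t) :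
    Θ (JetTorus.rho ρy dz (φ m t p).2) ≤ Θ (JetTorus.rho ρy dz p.2) + dy * t := by
  set r : ℝ → ℝ := fun s => JetTorus.rho ρy dz (φ m s p).2
  have hr : ∀ s, 0 ≤ s → r s ∈ Ioo 0 r₀ := fun s hs =>
    ⟨h.rho.rho_pos (h.snd_ne_zero m s hp), (h.rho_le m p hs).trans_lt hpr⟩
  set r' : ℝ → ℝ := fun s => (g ∘ clamp (δ m)) (r s) *
    (dy * ρy (φ m s p).2.1 + dz * (φ m s p).2.2 ^ dz)
  have hd : ∀ s, 0 ≤ s → HasDerivAt (fun s => Θ (r s)) (1 / (r s * g (r s)) * r' s) s :=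
    fun s hs => (hΘ _ (hr s hs)).comp s (hasDerivAt_rho_flow h.rho ((h.flow m).deriv p s))
  have hbound : ∀ s, 0 ≤ s → 1 / (r s * g (r s)) * r' s ≤ dy := by
    intro s hs
    have hrs := hr s hs
    have hg0 := h.profile.neg_of_lt hrs.1 hrs.2
    have h1 := h.profile.le_trunc (h.pos m) hrs.1
    have h2 := h.profile.trunc_nonpos (h.pos m) (r s)
    have hy := h.rho.y_nonneg (φ m s p).2.1
    have hz := h.rho.pow_z_nonneg (φ m s p).2.2
    have hdz : (dz : ℝ) ≤ dy := by exact_mod_cast h.rho.dz_le_dy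
    set S : ℝ := dy * ρy (φ m s p).2.1 + dz * (φ m s p).2.2 ^ dz with hS
    have hS0 : 0 ≤ S := by positivity
    have hS1 : S ≤ dy * r s := by
      simp only [r, JetTorus.rho, hS]
      nlinarith
    rw [one_div_mul_eq_div, div_le_iff_of_neg (mul_neg_of_pos_of_neg hrs.1 hg0)]
    simp only [r']
    nlinarith [mul_le_mul_of_nonneg_right h1 hS0]
  have := Convex.image_sub_le_mul_sub_of_deriv_le (convex_Ici (0 : ℝ)) (f := fun s => Θ (r s))
    (fun s hs => (hd s hs).continuousAt.continuousWithinAt)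
    (fun s hs => (hd s (interior_subset hs)).differentiableAt.differentiableWithinAt)
    (C := dy) (fun s hs => by
      rw [(hd s (interior_subset hs)).deriv]
      exact hbound s (interior_subset hs)) 0 self_mem_Ici t ht ht
  simp only [r, (h.flow m).zero, sub_zero] at this
  linarith

/-- Orbits starting near the zero section remain near it for bounded times, uniformly in the
truncation. -/
theorem exists_rho_lt (h : IsTruncatedFlow g r₀ ρy dy dz δ φ) (T : ℝ) {ε : ℝ} (hε : 0 < ε) :
    ∃ κ > 0, ∀ m p t, |t| ≤ T → JetTorus.rho ρy dz p.2 < κ →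
      JetTorus.rho ρy dz (φ m t p).2 < ε := by
  obtain ⟨Θ, hΘ, hΘtop⟩ := h.profile.exists_clock
  have hr₀ := h.profile.pos
  set ε' : ℝ := min ε (r₀ / 2)
  have hε' : 0 < ε' := lt_min hε (half_pos hr₀)
  have hε'r : ε' < r₀ := (min_le_right _ _).trans_lt (half_lt_self hr₀)
  have hanti : AntitoneOn Θ (Ioo 0 r₀) := by
    refine antitoneOn_of_deriv_nonpos (convex_Ioo 0 r₀)
      (fun r hr => (hΘ r hr).continuousAt.continuousWithinAt) ?_ ?_
    · rw [interior_Ioo]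
      exact fun r hr => (hΘ r hr).differentiableAt.differentiableWithinAt
    · rw [interior_Ioo]
      intro r hr
      rw [(hΘ r hr).deriv]
      exact div_nonpos_of_nonneg_of_nonpos zero_le_one
        (mul_nonpos_of_nonneg_of_nonpos hr.1.le (h.profile.nonpos r hr.1))
  obtain ⟨κ, hκ, hκΘ⟩ := mem_nhdsGT_iff_exists_Ioo_subset.1
    (hΘtop.eventually (eventually_gt_atTop (Θ ε' + dy * T)))
  refine ⟨min κ ε', lt_min hκ hε', fun m p t ht hp => ?_⟩
  have hpκ := hp.trans_le (min_le_left _ _)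
  have hpε := hp.trans_le (min_le_right _ _)
  refine lt_of_lt_of_le ?_ (min_le_left ε (r₀ / 2))
  rcases le_total 0 t with ht0 | ht0
  · exact (h.rho_le m p ht0).trans_lt hpε
  -- For `t ≤ 0`, `p` is reached from `φ m t p` in the forward time `-t`. If the earlier point had
  -- `ρ ≥ ε'`, the clock at `p` could not exceed `Θ ε' + dy T`, contrary to the choice of `κ`.
  by_contra! hc
  have hback : φ m (-t) (φ m t p) = p := h.neg_comp m t p
  by_cases hq : r₀ ≤ JetTorus.rho ρy dz (φ m t p).2
  · rw [h.eq_self_of_le m (-t) hq] at hback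
    rw [hback] at hc
    linarith
  · push Not at hq
    have hq0 : (φ m t p).2 ≠ 0 := h.rho.rho_pos_iff.1 (hε'.trans_le hc)
    have h1 := h.clock_le hΘ m hq0 hq (t := -t) (by linarith)
    rw [hback] at h1
    have hp0 : 0 < JetTorus.rho ρy dz p.2 := by
      rw [← hback]
      exact h.rho.rho_pos (h.snd_ne_zero m _ hq0)
    have h2 : Θ ε' + dy * T < Θ (JetTorus.rho ρy dz p.2) := hκΘ ⟨hp0, hpκ⟩
    have h3 := hanti ⟨hε', hε'r⟩ ⟨hε'.trans_le hc, hq⟩ hc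
    have h4 : (dy : ℝ) * -t ≤ dy * T := by
      gcongr
      exact (neg_le_abs t).trans ht
    linarith

/-- Apply `exists_rho_lt` to the inverse map, which is the flow at time `-t`. -/
theorem exists_le_rho (h : IsTruncatedFlow g r₀ ρy dy dz δ φ) (T : ℝ) {ε : ℝ} (hε : 0 < ε) :
    ∃ κ > 0, ∀ m p t, |t| ≤ T → ε ≤ JetTorus.rho ρy dz p.2 →
      κ ≤ JetTorus.rho ρy dz (φ m t p).2 := by
  obtain ⟨κ, hκ, H⟩ := h.exists_rho_lt T hε
  refine ⟨κ, hκ, fun m p t ht hp => ?_⟩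
  by_contra! hc
  have := H m (φ m t p) (-t) (by rwa [abs_neg]) hc
  rw [h.neg_comp] at this
  linarith

theorem field_trunc_eq (h : IsTruncatedFlow g r₀ ρy dy dz δ φ) {m : ℕ} {p : Cover n}
    (hp : 2 * δ m < JetTorus.rho ρy dz p.2) :
    field (g ∘ clamp (δ m)) ρy dy dz p = field g ρy dy dz p := by
  refine field_congr ?_
  filter_upwards [Ioi_mem_nhds hp] with r hr using IsProfile.trunc_eq (h.pos m) (le_of_lt hr)

theorem eventually_delta_lt (h : IsTruncatedFlow g r₀ ρy dy dz δ φ) {κ : ℝ} (hκ : 0 < κ) :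
    ∃ N, ∀ m ≥ N, 2 * δ m < κ := by
  obtain ⟨N, hN⟩ := eventually_atTop.1 (h.tendsto.eventually (gt_mem_nhds (half_pos hκ)))
  exact ⟨N, fun m hm => by linarith [hN m hm]⟩

/-- An integral curve of the untruncated field agrees with the truncated flow for a fine enough
truncation. -/
theorem eq_of_hasDerivAt (h : IsTruncatedFlow g r₀ ρy dy dz δ φ) {m : ℕ} {T : ℝ}
    {Γ : ℝ → Cover n} (hΓ : ∀ t ∈ Ioo (-T) T, HasDerivAt Γ (field g ρy dy dz (Γ t)) t)
    (hΓm : ∀ t ∈ Ioo (-T) T, 2 * δ m < JetTorus.rho ρy dz (Γ t).2) {t : ℝ}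
    (ht : t ∈ Ioo (-T) T) : Γ t = φ m t (Γ 0) := by
  obtain ⟨K, hK⟩ := h.exists_lipschitz m
  have hT : -T < T := ht.1.trans ht.2
  exact (h.flow m).eq_of_hasDerivAt_Ioo hK (a := -T) (b := T) (t₀ := 0)
    ⟨by linarith, by linarith⟩ (fun s hs => by
      rw [h.field_trunc_eq (hΓm s hs)]; exact hΓ s hs) ((h.flow m).zero _).symm ht

/-- Away from the zero section the truncated flows are eventually flows of the untruncated field,
and so they stabilize. -/
theorem exists_stable (h : IsTruncatedFlow g r₀ ρy dy dz δ φ) (T : ℝ) {ε : ℝ} (hε : 0 < ε) :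
    ∃ N, ∀ m ≥ N, ∀ p, ε ≤ JetTorus.rho ρy dz p.2 → ∀ t, |t| ≤ T →
      HasDerivAt (fun s => φ m s p) (field g ρy dy dz (φ m t p)) t ∧
      ∀ m' ≥ N, φ m t p = φ m' t p := by
  -- The extra unit of time makes the closed range `|t| ≤ T` lie in the open interval on which the
  -- two curves are compared.
  obtain ⟨κ, hκ, H⟩ := h.exists_le_rho (T + 1) hε
  obtain ⟨N, hN⟩ := h.eventually_delta_lt hκ
  have hd : ∀ m ≥ N, ∀ p, ε ≤ JetTorus.rho ρy dz p.2 → ∀ t, |t| ≤ T + 1 →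
      HasDerivAt (fun s => φ m s p) (field g ρy dy dz (φ m t p)) t := by
    intro m hm p hp t ht
    rw [← h.field_trunc_eq ((hN m hm).trans_le (H m p t ht hp))]
    exact (h.flow m).deriv p t
  refine ⟨N, fun m hm p hp t ht => ⟨hd m hm p hp t (by linarith), fun m' hm' => ?_⟩⟩
  have := h.eq_of_hasDerivAt (m := m') (T := T + 1) (Γ := fun s => φ m s p)
    (fun s hs => hd m hm p hp s (abs_le.2 ⟨hs.1.le, hs.2.le⟩))
    (fun s hs => (hN m' hm').trans_le (H m p s (abs_le.2 ⟨hs.1.le, hs.2.le⟩) hp))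
    (t := t) ⟨by linarith [neg_abs_le t], by linarith [le_abs_self t]⟩
  simpa only [(h.flow m).zero] using this

/-- The `x` speed is bounded by a multiple of `ρ^{1/dz - 1/dy} ρ (g ∘ clamp)'(ρ)`. Passing to the
clamped radius `k` only increases this, since `1/dz - 1/dy ≥ 0`, and then the decay condition
applies at `k`. -/
theorem exists_norm_field_fst_le (h : IsTruncatedFlow g r₀ ρy dy dz δ φ) {η : ℝ} (hη : 0 < η) :
    ∃ ε > 0, ∃ M, ∀ m ≥ M, ∀ p : Cover n, JetTorus.rho ρy dz p.2 < ε →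
      ‖(field (g ∘ clamp (δ m)) ρy dy dz p).1‖ ≤ η := by
  obtain ⟨C, hC0, hC⟩ := h.rho.exists_abs_mul_fderiv_le
  have hev := h.profile.decay.eventually (gt_mem_nhds (show 0 < η / (C + 1) by positivity))
  obtain ⟨ε, hε, hsub⟩ := mem_nhdsGT_iff_exists_Ioo_subset.1 hev
  obtain ⟨M, hM⟩ := h.eventually_delta_lt hε
  refine ⟨ε, hε, M, fun m hm p hp => ?_⟩
  refine (pi_norm_le_iff_of_nonneg hη.le).2 fun j => ?_
  by_cases hp0 : p.2 = 0
  · simp [field, hp0, hη.le]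
  set r := JetTorus.rho ρy dz p.2 with hr
  have hr0 : 0 < r := h.rho.rho_pos hp0
  set k := clamp (δ m) r with hk
  have hk0 : 0 < k := clamp_pos (h.pos m) r
  have hkε : k < ε := (clamp_le_max (h.pos m) r).trans_lt (max_lt hp (hM m hm))
  have h1 : k ^ (1 / (dz : ℝ) - 1 / (dy : ℝ)) * (k * deriv g k) < η / (C + 1) := hsub ⟨hk0, hkε⟩
  have hexp : 0 ≤ 1 / (dz : ℝ) - 1 / (dy : ℝ) := by
    have h2 : (0 : ℝ) < dz := by exact_mod_cast h.rho.dz_ne_zero.bot_lt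
    have h3 : (dz : ℝ) ≤ dy := by exact_mod_cast h.rho.dz_le_dy
    exact sub_nonneg.2 (one_div_le_one_div_of_le h2 h3)
  have hG := h.profile.deriv_trunc_nonneg (h.pos m) r
  have hGr := h.profile.mul_deriv_trunc_le (h.pos m) r
  have hpow : r ^ (1 / (dz : ℝ) - 1 / (dy : ℝ)) ≤ k ^ (1 / (dz : ℝ) - 1 / (dy : ℝ)) :=
    Real.rpow_le_rpow hr0.le (le_clamp (h.pos m) r) hexp
  have hkg : 0 ≤ k * deriv g k := mul_nonneg hk0.le (h.profile.deriv_nonneg k hk0)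
  simp only [field, ← hr]
  rw [norm_neg, norm_mul, Real.norm_of_nonneg hG, Real.norm_eq_abs]
  calc deriv (g ∘ clamp (δ m)) r * |p.2.2 * fderiv ℝ ρy p.2.1 (Pi.single j 1)|
      ≤ deriv (g ∘ clamp (δ m)) r * (C * (r ^ (1 / (dz : ℝ) - 1 / (dy : ℝ)) * r)) := by
        gcongr
        exact hC p.2 j hp0
    _ = C * (r ^ (1 / (dz : ℝ) - 1 / (dy : ℝ)) * (r * deriv (g ∘ clamp (δ m)) r)) := by ring
    _ ≤ C * (k ^ (1 / (dz : ℝ) - 1 / (dy : ℝ)) * (k * deriv g k)) := by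
        refine mul_le_mul_of_nonneg_left ?_ hC0
        exact mul_le_mul hpow hGr (mul_nonneg hr0.le hG) (Real.rpow_nonneg hk0.le _)
    _ ≤ C * (η / (C + 1)) := by gcongr
    _ ≤ η := by
        rw [mul_div_assoc', div_le_iff₀ (by positivity)]
        nlinarith

/-- Near the zero section the truncated flows are uniformly close to the identity. -/
theorem exists_dist_le (h : IsTruncatedFlow g r₀ ρy dy dz δ φ) (T : ℝ) {η : ℝ} (hη : 0 < η) :
    ∃ ε > 0, ∃ M, ∀ m ≥ M, ∀ p, JetTorus.rho ρy dz p.2 < ε → ∀ t, |t| ≤ T →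
      dist (φ m t p) p ≤ η := by
  obtain ⟨ε₁, hε₁, M, hM⟩ := h.exists_norm_field_fst_le (η := η / (|T| + 1)) (by positivity)
  obtain ⟨ε₂, hε₂, hw⟩ := h.rho.exists_norm_lt_of_rho_lt (half_pos hη)
  obtain ⟨κ, hκ, H⟩ := h.exists_rho_lt T (lt_min hε₁ hε₂)
  refine ⟨min κ ε₂, lt_min hκ hε₂, M, fun m hm p hp t ht => ?_⟩
  have hT : 0 ≤ T := (abs_nonneg t).trans ht
  have hsmall : ∀ s, |s| ≤ T → JetTorus.rho ρy dz (φ m s p).2 < min ε₁ ε₂ := fun s hs =>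
    H m p s hs (hp.trans_le (min_le_left _ _))
  rw [Prod.dist_eq]
  refine max_le ?_ ?_
  -- The `x` displacement is controlled by the small speed, as the orbit stays where that speed
  -- bound holds.
  · have hd : ∀ s, HasDerivAt (fun s => (φ m s p).1)
        (field (g ∘ clamp (δ m)) ρy dy dz (φ m s p)).1 s := fun s =>
      (ContinuousLinearMap.fst ℝ (Fin n → ℝ) ((Fin n → ℝ) × ℝ)).hasFDerivAt.comp_hasDerivAt s
        ((h.flow m).deriv p s)
    have := Convex.norm_image_sub_le_of_norm_hasDerivWithin_le (s := Icc (-T) T)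
      (fun s _ => (hd s).hasDerivWithinAt) (C := η / (|T| + 1))
      (fun s hs => hM m hm _ ((hsmall s (abs_le.2 hs)).trans_le (min_le_left _ _)))
      (convex_Icc _ _) (x := 0) (y := t) ⟨by linarith, hT⟩ (abs_le.1 ht)
    rw [(h.flow m).zero, ← dist_eq_norm, sub_zero] at this
    refine this.trans ?_
    rw [Real.norm_eq_abs, div_mul_eq_mul_div, div_le_iff₀ (by positivity)]
    gcongr
    linarith [le_abs_self T]
  -- No speed is needed for `(y, z)`: both endpoints are within `η / 2` of the origin.
  · have h1 := hw _ ((hsmall t ht).trans_le (min_le_right _ _))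
    have h2 := hw _ (hp.trans_le (min_le_right _ _))
    rw [dist_eq_norm]
    exact (norm_sub_le _ _).trans (by linarith)

end IsTruncatedFlow

end JetTorus

/-! ### The limit flow -/

namespace JetTorus

open LipschitzFlow
open scoped NNReal

variable {n : ℕ}

/-- `Φ` is the limit of the truncated flows `φ m`. -/
structure IsLimitFlow (g : ℝ → ℝ) (r₀ : ℝ) (ρy : (Fin n → ℝ) → ℝ) (dy dz : ℕ) (δ : ℕ → ℝ)
    (φ : ℕ → ℝ → Cover n → Cover n) (Φ : ℝ → Cover n → Cover n) : Prop where
  trunc : IsTruncatedFlow g r₀ ρy dy dz δ φ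
  eq_self : ∀ t p, p.2 = 0 → Φ t p = p
  stable : ∀ ε, 0 < ε → ∀ T, ∃ N, ∀ m ≥ N, ∀ p, ε ≤ rho ρy dz p.2 → ∀ t, |t| ≤ T →
    Φ t p = φ m t p

theorem IsTruncatedFlow.exists_isLimitFlow {g : ℝ → ℝ} {r₀ : ℝ} {ρy : (Fin n → ℝ) → ℝ}
    {dy dz : ℕ} {δ : ℕ → ℝ} {φ : ℕ → ℝ → Cover n → Cover n}
    (h : IsTruncatedFlow g r₀ ρy dy dz δ φ) : ∃ Φ, IsLimitFlow g r₀ ρy dy dz δ φ Φ := by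
  have key : ∀ (t : ℝ) (p : Cover n), ∃ N, p.2 ≠ 0 → ∀ m ≥ N, φ N t p = φ m t p := by
    intro t p
    by_cases hp : p.2 = 0
    · exact ⟨0, fun h => absurd hp h⟩
    · obtain ⟨N, hN⟩ := h.exists_stable |t| (h.rho.rho_pos hp)
      exact ⟨N, fun _ m hm => (hN N le_rfl p le_rfl t le_rfl).2 m hm⟩
  choose N hN using key
  -- Off the zero section the limit is the eventually constant value of the truncated flows; the
  -- index `N t p` depends on the point, and `stable` then makes it uniform on `{ρ ≥ ε}`.
  refine ⟨fun t p => if p.2 = 0 then p else φ (N t p) t p, h, fun t p hp => if_pos hp, ?_⟩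
  intro ε hε T
  obtain ⟨N', hN'⟩ := h.exists_stable T hε
  refine ⟨N', fun m hm p hp t ht => ?_⟩
  have hp0 : p.2 ≠ 0 := h.rho.rho_pos_iff.1 (hε.trans_le hp)
  rw [if_neg hp0, hN t p hp0 (max (N t p) N') (le_max_left _ _)]
  exact ((hN' m hm p hp t ht).2 _ (le_max_right _ _)).symm

/-- The factor by which the truncated flow rescales the contact form. -/
def truncFactor (g : ℝ → ℝ) (ρy : (Fin n → ℝ) → ℝ) (dz : ℕ) (δ : ℕ → ℝ)
    (φ : ℕ → ℝ → Cover n → Cover n) (m : ℕ) (t : ℝ) (p : Cover n) : ℝ :=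
  Real.exp (∫ s in (0 : ℝ)..t, reebDeriv (g ∘ clamp (δ m)) ρy dz (φ m s p).2)

/-- The factor by which the limit flow rescales the contact form, extended by zero. -/
def limitFactor (Φ : ℝ → Cover n → Cover n) (t : ℝ) (p : Cover n) : ℝ :=
  if p.2 = 0 then 0 else alpha (Φ t p) (fderiv ℝ (Φ t) p (0, 0, 1))

theorem alpha_reeb (p : Cover n) : alpha p (0, 0, 1) = 1 := by simp [alpha_apply]

namespace IsTruncatedFlow

variable {g : ℝ → ℝ} {r₀ : ℝ} {ρy : (Fin n → ℝ) → ℝ} {dy dz : ℕ} {δ : ℕ → ℝ}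
  {φ : ℕ → ℝ → Cover n → Cover n}

theorem alpha_fderiv (h : IsTruncatedFlow g r₀ ρy dy dz δ φ) (m : ℕ) (t : ℝ) (p v : Cover n) :
    alpha (φ m t p) (fderiv ℝ (φ m t) p v) = truncFactor g ρy dz δ φ m t p * alpha p v :=
  let ⟨_, hK⟩ := h.exists_lipschitz m
  alpha_fderiv_flow h.rho (h.contDiff_trunc m) hK (h.flow m) t p v

theorem truncFactor_eq (h : IsTruncatedFlow g r₀ ρy dy dz δ φ) (m : ℕ) (t : ℝ) (p : Cover n) :
    truncFactor g ρy dz δ φ m t p = alpha (φ m t p) (fderiv ℝ (φ m t) p (0, 0, 1)) := by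
  rw [h.alpha_fderiv, alpha_reeb, mul_one]

theorem contDiff_truncFactor (h : IsTruncatedFlow g r₀ ρy dy dz δ φ) (m : ℕ) (t : ℝ) :
    ContDiff ℝ ∞ (truncFactor g ρy dz δ φ m t) := by
  rw [funext (h.truncFactor_eq m t)]
  simp only [alpha_apply]
  have h1 : ContDiff ℝ ∞ fun p => fderiv ℝ (φ m t) p (0, 0, 1) :=
    ((h.contDiff m t).fderiv_right (m := ∞) (by simp)).clm_apply contDiff_const
  refine (contDiff_snd.comp (contDiff_snd.comp h1)).sub (ContDiff.sum fun j _ => ?_)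
  exact (contDiff_pi.1 (contDiff_fst.comp (contDiff_snd.comp (h.contDiff m t))) j).mul
    (contDiff_pi.1 (contDiff_fst.comp h1) j)

theorem truncFactor_translate (h : IsTruncatedFlow g r₀ ρy dy dz δ φ) (m : ℕ) (t : ℝ)
    (p : Cover n) (a : Fin n → ℝ) :
    truncFactor g ρy dz δ φ m t (p.1 + a, p.2) = truncFactor g ρy dz δ φ m t p := by
  simp only [truncFactor, h.add_translate]

/-- For positive times the conformal factors are uniformly small near the zero section. -/
theorem exists_truncFactor_le (h : IsTruncatedFlow g r₀ ρy dy dz δ φ)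
    (hg : Tendsto g (𝓝[>] 0) atBot) {t : ℝ} (ht : 0 < t) {η : ℝ} (hη : 0 < η) :
    ∃ ε > 0, ∃ M, ∀ m ≥ M, ∀ p, JetTorus.rho ρy dz p.2 < ε → truncFactor g ρy dz δ φ m t p ≤ η := by
  set L : ℝ := Real.log η / t with hL
  have hdz : (0 : ℝ) < dz := by exact_mod_cast h.rho.dz_ne_zero.bot_lt
  -- Condition (v) gives `dz r g' ≤ -g / 2` near `0`, so the left side is at most `g / 2`, and it
  -- suffices that `g ≤ 2 L`.
  have hev : ∀ᶠ r in 𝓝[>] (0 : ℝ), g r + dz * (r * deriv g r) ≤ L := by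
    have h1 := h.profile.log_deriv.eventually
      (Ioo_mem_nhds (show -(1 / (2 * dz : ℝ)) < 0 by simp [hdz]) (by positivity))
    filter_upwards [h1, hg.eventually (eventually_le_atBot (2 * L)),
      hg.eventually (eventually_lt_atBot 0)] with r h2 h3 h4
    have h5 : r * deriv g r < -(1 / (2 * dz : ℝ)) * g r := (lt_div_iff_of_neg h4).1 h2.1
    have h6 : dz * (r * deriv g r) ≤ dz * (-(1 / (2 * dz : ℝ)) * g r) := by gcongr
    have h7 : dz * (-(1 / (2 * dz : ℝ)) * g r) = -(g r / 2) := by field_simp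
    linarith
  obtain ⟨ε, hε, hsub⟩ := mem_nhdsGT_iff_exists_Ioo_subset.1 hev
  obtain ⟨M, hM⟩ := h.eventually_delta_lt hε
  refine ⟨ε, hε, M, fun m hm p hp => ?_⟩
  -- Forward in time `ρ` does not increase, so the whole orbit segment stays where the estimate
  -- holds. The bound `L` for the integrand makes the factor at most `exp (t L) = η`.
  have hle : ∀ s, 0 ≤ s → reebDeriv (g ∘ clamp (δ m)) ρy dz (φ m s p).2 ≤ L := by
    intro s hs
    set r := JetTorus.rho ρy dz (φ m s p).2 with hr
    have hrε : r < ε := (h.rho_le m p hs).trans_lt hp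
    set k := clamp (δ m) r with hk
    have hk0 : 0 < k := clamp_pos (h.pos m) r
    have hkε : k < ε := (clamp_le_max (h.pos m) r).trans_lt (max_lt hrε (hM m hm))
    have h1 : g k + dz * (k * deriv g k) ≤ L := hsub ⟨hk0, hkε⟩
    have hz : (φ m s p).2.2 ^ dz ≤ r := by
      rw [hr, JetTorus.rho]
      linarith [h.rho.y_nonneg (φ m s p).2.1]
    have h2 := h.profile.mul_deriv_trunc_le (h.pos m) r
    have h3 := h.profile.deriv_trunc_nonneg (h.pos m) r
    rw [reebDeriv, ← hr, Function.comp_apply, ← hk]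
    calc g k + deriv (g ∘ clamp (δ m)) r * (dz * (φ m s p).2.2 ^ dz)
        ≤ g k + deriv (g ∘ clamp (δ m)) r * (dz * r) := by gcongr
      _ = g k + dz * (r * deriv (g ∘ clamp (δ m)) r) := by ring
      _ ≤ g k + dz * (k * deriv g k) := by gcongr
      _ ≤ L := h1
  have hcont : Continuous fun s => reebDeriv (g ∘ clamp (δ m)) ρy dz (φ m s p).2 :=
    (contDiff_reebDeriv h.rho (h.contDiff_trunc m)).continuous.comp
      ((h.flow m).continuous_curve p).snd
  have hint := intervalIntegral.integral_mono_on ht.le (hcont.intervalIntegrable 0 t)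
    (intervalIntegrable_const (μ := MeasureTheory.volume) (c := L)) fun s hs => hle s hs.1
  rw [truncFactor, ← Real.le_log_iff_exp_le hη]
  refine hint.trans (le_of_eq ?_)
  rw [intervalIntegral.integral_const, sub_zero, smul_eq_mul, hL, mul_div_cancel₀ _ ht.ne']

end IsTruncatedFlow

namespace IsLimitFlow

variable {g : ℝ → ℝ} {r₀ : ℝ} {ρy : (Fin n → ℝ) → ℝ} {dy dz : ℕ} {δ : ℕ → ℝ}
  {φ : ℕ → ℝ → Cover n → Cover n} {Φ : ℝ → Cover n → Cover n}

/-- Pointwise, the limit flow agrees with all fine enough truncated flows. -/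
theorem eventually_eq (h : IsLimitFlow g r₀ ρy dy dz δ φ Φ) (t : ℝ) (p : Cover n) :
    ∀ᶠ m in atTop, Φ t p = φ m t p := by
  by_cases hp : p.2 = 0
  · exact Eventually.of_forall fun m => by rw [h.eq_self t p hp, h.trunc.eq_self m t hp]
  · obtain ⟨N, hN⟩ := h.stable _ (h.trunc.rho.rho_pos hp) |t|
    exact eventually_atTop.2 ⟨N, fun m hm => hN m hm p le_rfl t le_rfl⟩

theorem exists_eventuallyEq (h : IsLimitFlow g r₀ ρy dy dz δ φ Φ) (T : ℝ) {ε : ℝ} (hε : 0 < ε) :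
    ∃ N, ∀ m ≥ N, ∀ p, ε ≤ rho ρy dz p.2 → ∀ t, |t| ≤ T → Φ t =ᶠ[𝓝 p] φ m t := by
  obtain ⟨N, hN⟩ := h.stable (ε / 2) (half_pos hε) T
  refine ⟨N, fun m hm p hp t ht => ?_⟩
  have h1 : ∀ᶠ q in 𝓝 p, ε / 2 < rho ρy dz q.2 :=
    (h.trunc.rho.continuous_rho.comp continuous_snd).continuousAt.eventually
      (lt_mem_nhds ((half_lt_self hε).trans_le hp))
  filter_upwards [h1] with q hq using hN m hm q hq.le t ht

theorem zero (h : IsLimitFlow g r₀ ρy dy dz δ φ Φ) (p : Cover n) : Φ 0 p = p := by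
  obtain ⟨m, hm⟩ := (h.eventually_eq 0 p).exists
  rw [hm, (h.trunc.flow m).zero]

theorem neg_comp (h : IsLimitFlow g r₀ ρy dy dz δ φ Φ) (t : ℝ) (p : Cover n) :
    Φ (-t) (Φ t p) = p := by
  obtain ⟨m, hm, hm'⟩ := ((h.eventually_eq t p).and (h.eventually_eq (-t) (Φ t p))).exists
  rw [hm', hm, h.trunc.neg_comp]

theorem add_translate (h : IsLimitFlow g r₀ ρy dy dz δ φ Φ) (t : ℝ) (p : Cover n)
    (a : Fin n → ℝ) : Φ t (p.1 + a, p.2) = ((Φ t p).1 + a, (Φ t p).2) := by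
  obtain ⟨m, hm, hm'⟩ := ((h.eventually_eq t p).and (h.eventually_eq t (p.1 + a, p.2))).exists
  rw [hm', hm, h.trunc.add_translate]

theorem eq_self_of_le (h : IsLimitFlow g r₀ ρy dy dz δ φ Φ) (t : ℝ) {p : Cover n}
    (hp : r₀ ≤ rho ρy dz p.2) : Φ t p = p := by
  obtain ⟨m, hm⟩ := (h.eventually_eq t p).exists
  rw [hm, h.trunc.eq_self_of_le m t hp]

theorem snd_ne_zero (h : IsLimitFlow g r₀ ρy dy dz δ φ Φ) (t : ℝ) {p : Cover n}
    (hp : p.2 ≠ 0) : (Φ t p).2 ≠ 0 := by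
  obtain ⟨m, hm⟩ := (h.eventually_eq t p).exists
  rw [hm]
  exact h.trunc.snd_ne_zero m t hp

theorem hasDerivAt (h : IsLimitFlow g r₀ ρy dy dz δ φ Φ) {p : Cover n} (hp : p.2 ≠ 0) (t : ℝ) :
    HasDerivAt (fun s => Φ s p) (field g ρy dy dz (Φ t p)) t := by
  have hpos := h.trunc.rho.rho_pos hp
  obtain ⟨N, hN⟩ := h.stable _ hpos (|t| + 1)
  obtain ⟨N', hN'⟩ := h.trunc.exists_stable (|t| + 1) hpos
  set m := max N N'
  have h1 := (hN' m (le_max_right _ _) p le_rfl t (by linarith)).1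
  rw [← hN m (le_max_left _ _) p le_rfl t (by linarith)] at h1
  refine h1.congr_of_eventuallyEq ?_
  have h2 : ∀ᶠ s in 𝓝 t, |s| < |t| + 1 :=
    continuous_abs.continuousAt.eventually (gt_mem_nhds (lt_add_one |t|))
  filter_upwards [h2] with s hs using hN m (le_max_left _ _) p le_rfl s hs.le

theorem contDiffAt (h : IsLimitFlow g r₀ ρy dy dz δ φ Φ) {p : Cover n} (hp : p.2 ≠ 0) (t : ℝ) :
    ContDiffAt ℝ ∞ (Φ t) p := by
  obtain ⟨N, hN⟩ := h.exists_eventuallyEq |t| (h.trunc.rho.rho_pos hp)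
  exact (h.trunc.contDiff N t).contDiffAt.congr_of_eventuallyEq
    (hN N le_rfl p le_rfl t le_rfl)

/-- Integral curves of the untruncated field off the zero section are orbits of the limit flow. -/
theorem eq_of_hasDerivAt (h : IsLimitFlow g r₀ ρy dy dz δ φ Φ) {Γ : ℝ → Cover n}
    (hΓ : ∀ t, HasDerivAt Γ (field g ρy dy dz (Γ t)) t) (hΓ0 : ∀ t, (Γ t).2 ≠ 0) (t : ℝ) :
    Γ t = Φ t (Γ 0) := by
  set T : ℝ := |t| + 1
  have hΓc : Continuous Γ := continuous_iff_continuousAt.2 fun t => (hΓ t).continuousAt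
  have hc : Continuous fun s => rho ρy dz (Γ s).2 := h.trunc.rho.continuous_rho.comp hΓc.snd
  have hne : (Icc (-T) T).Nonempty := ⟨t, by
    constructor
    · linarith [neg_abs_le t]
    · linarith [le_abs_self t]⟩
  -- On a compact time interval the curve keeps a positive distance from the zero section in terms
  -- of `ρ`, so a fine enough truncation does not change the field along it.
  obtain ⟨s₀, -, hs₀⟩ := isCompact_Icc.exists_isMinOn hne hc.continuousOn
  obtain ⟨N, hN⟩ := h.trunc.eventually_delta_lt (h.trunc.rho.rho_pos (hΓ0 s₀))
  obtain ⟨m, hm, hm'⟩ := ((h.eventually_eq t (Γ 0)).and (eventually_ge_atTop N)).exists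
  rw [hm]
  exact h.trunc.eq_of_hasDerivAt (T := T) (fun s _ => hΓ s)
    (fun s hs => (hN m hm').trans_le (hs₀ ⟨hs.1.le, hs.2.le⟩))
    ⟨by linarith [neg_abs_le t], by linarith [le_abs_self t]⟩

/-- The truncated flows converge uniformly to the limit flow. -/
theorem exists_dist_le (h : IsLimitFlow g r₀ ρy dy dz δ φ Φ) (t : ℝ) {η : ℝ} (hη : 0 < η) :
    ∃ M, ∀ m ≥ M, ∀ p, dist (φ m t p) (Φ t p) ≤ η := by
  obtain ⟨ε, hε, M, hM⟩ := h.trunc.exists_dist_le |t| (half_pos hη)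
  obtain ⟨N, hN⟩ := h.stable ε hε |t|
  refine ⟨max M N, fun m hm p => ?_⟩
  rcases lt_or_ge (rho ρy dz p.2) ε with hp | hp
  -- Near the zero section the limit equals some later truncated flow, and both maps are within `η /
  -- 2` of the identity.
  · obtain ⟨m', hm', hm''⟩ := ((h.eventually_eq t p).and (eventually_ge_atTop M)).exists
    have h1 := hM m ((le_max_left _ _).trans hm) p hp t le_rfl
    have h2 := hM m' hm'' p hp t le_rfl
    rw [hm']
    linarith [dist_triangle_right (φ m t p) (φ m' t p) p]
  · rw [hN m ((le_max_right _ _).trans hm) p hp t le_rfl, dist_self]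
    exact hη.le

theorem tendstoUniformly (h : IsLimitFlow g r₀ ρy dy dz δ φ Φ) (t : ℝ) :
    TendstoUniformly (fun m => φ m t) (Φ t) atTop := by
  refine Metric.tendstoUniformly_iff.2 fun η hη => ?_
  obtain ⟨M, hM⟩ := h.exists_dist_le t (half_pos hη)
  filter_upwards [eventually_ge_atTop M] with m hm p
  rw [dist_comm]
  exact (hM m hm p).trans_lt (half_lt_self hη)

theorem continuous (h : IsLimitFlow g r₀ ρy dy dz δ φ Φ) (t : ℝ) : Continuous (Φ t) :=
  (h.tendstoUniformly t).continuous
    (Frequently.of_forall fun m => (h.trunc.contDiff m t).continuous)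

theorem exists_limitFactor_eq (h : IsLimitFlow g r₀ ρy dy dz δ φ Φ) (t : ℝ) {ε : ℝ} (hε : 0 < ε) :
    ∃ N, ∀ m ≥ N, ∀ p, ε ≤ rho ρy dz p.2 → limitFactor Φ t p = truncFactor g ρy dz δ φ m t p := by
  obtain ⟨N, hN⟩ := h.exists_eventuallyEq |t| hε
  refine ⟨N, fun m hm p hp => ?_⟩
  have h1 := hN m hm p hp t le_rfl
  rw [limitFactor, if_neg (h.trunc.rho.rho_pos_iff.1 (hε.trans_le hp)), h1.fderiv_eq,
    h1.eq_of_nhds, h.trunc.truncFactor_eq]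

theorem alpha_fderiv (h : IsLimitFlow g r₀ ρy dy dz δ φ Φ) {p : Cover n} (hp : p.2 ≠ 0) (t : ℝ)
    (v : Cover n) : alpha (Φ t p) (fderiv ℝ (Φ t) p v) = limitFactor Φ t p * alpha p v := by
  obtain ⟨N, hN⟩ := h.exists_eventuallyEq |t| (h.trunc.rho.rho_pos hp)
  obtain ⟨N', hN'⟩ := h.exists_limitFactor_eq t (h.trunc.rho.rho_pos hp)
  have h1 := hN (max N N') (le_max_left _ _) p le_rfl t le_rfl
  rw [hN' (max N N') (le_max_right _ _) p le_rfl, h1.fderiv_eq, h1.eq_of_nhds,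
    h.trunc.alpha_fderiv]

theorem limitFactor_nonneg (h : IsLimitFlow g r₀ ρy dy dz δ φ Φ) (t : ℝ) (p : Cover n) :
    0 ≤ limitFactor Φ t p := by
  by_cases hp : p.2 = 0
  · rw [limitFactor, if_pos hp]
  · obtain ⟨N, hN⟩ := h.exists_limitFactor_eq t (h.trunc.rho.rho_pos hp)
    rw [hN N le_rfl p le_rfl]
    exact (Real.exp_pos _).le

/-- For positive times the conformal factors converge uniformly. -/
theorem tendstoUniformly_factor (h : IsLimitFlow g r₀ ρy dy dz δ φ Φ)
    (hg : Tendsto g (𝓝[>] 0) atBot) {t : ℝ} (ht : 0 < t) :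
    TendstoUniformly (fun m => truncFactor g ρy dz δ φ m t) (limitFactor Φ t) atTop := by
  refine Metric.tendstoUniformly_iff.2 fun η hη => ?_
  obtain ⟨ε, hε, M, hM⟩ := h.trunc.exists_truncFactor_le hg ht (half_pos hη)
  obtain ⟨N, hN⟩ := h.exists_limitFactor_eq t hε
  filter_upwards [eventually_ge_atTop (max M N)] with m hm p
  rcases lt_or_ge (rho ρy dz p.2) ε with hp | hp
  · have h1 := hM m ((le_max_left _ _).trans hm) p hp
    have h1' : 0 ≤ truncFactor g ρy dz δ φ m t p := (Real.exp_pos _).le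
    have h2 : limitFactor Φ t p ≤ η / 2 := by
      by_cases hp0 : p.2 = 0
      · rw [limitFactor, if_pos hp0]
        exact (half_pos hη).le
      · obtain ⟨N', hN'⟩ := h.exists_limitFactor_eq t (h.trunc.rho.rho_pos hp0)
        rw [hN' (max M N') (le_max_right _ _) p le_rfl]
        exact hM _ (le_max_left _ _) p hp
    have h2' := h.limitFactor_nonneg t p
    rw [Real.dist_eq, abs_lt]
    constructor <;> linarith
  · rw [hN m ((le_max_right _ _).trans hm) p hp, dist_self]
    exact hη

theorem limitFactor_translate (h : IsLimitFlow g r₀ ρy dy dz δ φ Φ) (t : ℝ) (p : Cover n)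
    (a : Fin n → ℝ) : limitFactor Φ t (p.1 + a, p.2) = limitFactor Φ t p := by
  by_cases hp : p.2 = 0
  · simp [limitFactor, hp]
  · obtain ⟨N, hN⟩ := h.exists_limitFactor_eq t (h.trunc.rho.rho_pos hp)
    rw [hN N le_rfl p le_rfl, hN N le_rfl (p.1 + a, p.2) le_rfl, h.trunc.truncFactor_translate]

end IsLimitFlow

end JetTorus

/-! ### Descent from the cover -/

namespace JetTorus

open LipschitzFlow
open scoped NNReal

variable {n : ℕ}

theorem proj_surjective : Function.Surjective (proj : Cover n → Jet n) := by
  intro q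
  choose x hx using fun j => QuotientAddGroup.mk_surjective (q.1 j)
  exact ⟨(x, q.2), Prod.ext (funext hx) rfl⟩

/-- Transfers uniform closeness of lifts to the maps they induce on the quotient. -/
theorem dist_proj_le (p q : Cover n) : dist (proj p) (proj q) ≤ dist p q := by
  rw [Prod.dist_eq, Prod.dist_eq]
  refine max_le_max ((dist_pi_le_iff dist_nonneg).2 fun j => ?_) le_rfl
  refine le_trans ?_ (dist_le_pi_dist p.1 q.1 j)
  rw [dist_eq_norm, dist_eq_norm]
  exact QuotientAddGroup.norm_mk_le_norm (S := AddSubgroup.zmultiples (1 : ℝ)) (m := p.1 j - q.1 j)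

/-- `f` commutes with translations in `x`. -/
def IsEquivariant (f : Cover n → Cover n) : Prop :=
  ∀ p (a : Fin n → ℝ), f (p.1 + a, p.2) = ((f p).1 + a, (f p).2)

/-- The map of `(ℝ/ℤ)ⁿ × ℝⁿ × ℝ` induced by an equivariant map of the cover. -/
def descend (f : Cover n → Cover n) (q : Jet n) : Jet n :=
  (fun j => q.1 j + ((f (0, q.2)).1 j : UnitAddCircle), (f (0, q.2)).2)

theorem descend_proj {f : Cover n → Cover n} (hf : IsEquivariant f) (p : Cover n) :
    descend f (proj p) = proj (f p) := by
  have h1 := hf (0, p.2) p.1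
  simp only [zero_add] at h1
  have h2 : f p = ((f (0, p.2)).1 + p.1, (f (0, p.2)).2) := h1
  rw [h2]
  refine Prod.ext (funext fun j => ?_) rfl
  simp [descend, proj, add_comm]

theorem continuous_descend {f : Cover n → Cover n} (hf : Continuous f) : Continuous (descend f) := by
  have h1 : Continuous fun q : Jet n => f (0, q.2) :=
    hf.comp (continuous_const.prodMk continuous_snd)
  refine Continuous.prodMk (continuous_pi fun j => ?_) h1.snd
  exact ((continuous_apply j).comp continuous_fst).add
    ((AddCircle.continuous_mk' (1 : ℝ)).comp ((continuous_apply j).comp h1.fst))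

theorem descend_leftInverse {f f' : Cover n → Cover n} (hf : IsEquivariant f)
    (hf' : IsEquivariant f') (h : ∀ p, f' (f p) = p) (q : Jet n) :
    descend f' (descend f q) = q := by
  obtain ⟨p, rfl⟩ := proj_surjective q
  rw [descend_proj hf, descend_proj hf', h]

theorem dist_descend_le {f f' : Cover n → Cover n} (hf : IsEquivariant f)
    (hf' : IsEquivariant f') {η : ℝ} (h : ∀ p, dist (f p) (f' p) ≤ η) (q : Jet n) :
    dist (descend f q) (descend f' q) ≤ η := by
  obtain ⟨p, rfl⟩ := proj_surjective q
  rw [descend_proj hf, descend_proj hf']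
  exact (dist_proj_le _ _).trans (h p)

/-- A pair of mutually inverse equivariant maps of the cover, preserving the preimage of `U`. -/
structure IsLiftedAut (U : Set (Jet n)) (f f' : Cover n → Cover n) : Prop where
  equivariant : IsEquivariant f
  equivariant' : IsEquivariant f'
  left_inv : ∀ p, f' (f p) = p
  right_inv : ∀ p, f (f' p) = p
  mem : ∀ p, proj p ∈ U → proj (f p) ∈ U
  mem' : ∀ p, proj p ∈ U → proj (f' p) ∈ U

namespace IsLiftedAut

variable {U : Set (Jet n)} {f f' : Cover n → Cover n}

theorem symm (h : IsLiftedAut U f f') : IsLiftedAut U f' f :=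
  ⟨h.equivariant', h.equivariant, h.right_inv, h.left_inv, h.mem', h.mem⟩

theorem mapsTo (h : IsLiftedAut U f f') : MapsTo (descend f) U U := by
  intro q hq
  obtain ⟨p, rfl⟩ := proj_surjective q
  rw [descend_proj h.equivariant]
  exact h.mem p hq

/-- The induced bijection of `U`. -/
def equiv (h : IsLiftedAut U f f') : U ≃ U where
  toFun q := ⟨descend f q, h.mapsTo q.2⟩
  invFun q := ⟨descend f' q, h.symm.mapsTo q.2⟩
  left_inv q := Subtype.ext (descend_leftInverse h.equivariant h.equivariant' h.left_inv q)
  right_inv q := Subtype.ext (descend_leftInverse h.equivariant' h.equivariant h.right_inv q)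

theorem equiv_proj (h : IsLiftedAut U f f') (p : Cover n) (hp : proj p ∈ U) :
    (h.equiv ⟨proj p, hp⟩ : Jet n) = proj (f p) := descend_proj h.equivariant p

/-- The induced homeomorphism of `U`. -/
def homeo (h : IsLiftedAut U f f') (hf : Continuous f) (hf' : Continuous f') : U ≃ₜ U where
  toEquiv := h.equiv
  continuous_toFun := ((continuous_descend hf).comp continuous_subtype_val).subtype_mk _
  continuous_invFun := ((continuous_descend hf').comp continuous_subtype_val).subtype_mk _

theorem isSmoothLiftAt (h : IsLiftedAut U f f') {p : Cover n} (hf : ContDiffAt ℝ ∞ f p) :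
    IsSmoothLiftAt h.equiv p f :=
  ⟨hf, Eventually.of_forall fun q hq => h.equiv_proj q hq⟩

theorem isDiffeo (h : IsLiftedAut U f f') (hf : ∀ p, proj p ∈ U → ContDiffAt ℝ ∞ f p)
    (hf' : ∀ p, proj p ∈ U → ContDiffAt ℝ ∞ f' p) : IsDiffeo h.equiv :=
  ⟨fun p hp => ⟨f, h.isSmoothLiftAt (hf p hp)⟩, h.equiv.symm,
    fun p hp => ⟨f', h.symm.isSmoothLiftAt (hf' p hp)⟩, h.equiv.left_inv, h.equiv.right_inv⟩

/-- A nonzero conformal factor makes the differential both preserve and reflect membership in `ker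
α`; surjectivity onto the kernel comes from the differential of the inverse. -/
theorem isContactomorphism (h : IsLiftedAut U f f') (hf : ContDiff ℝ ∞ f) (hf' : ContDiff ℝ ∞ f')
    {a : Cover n → ℝ} (ha : ∀ p, a p ≠ 0)
    (hα : ∀ p v, alpha (f p) (fderiv ℝ f p v) = a p * alpha p v) :
    IsContactomorphism h.equiv := by
  refine ⟨h.isDiffeo (fun p _ => hf.contDiffAt) (fun p _ => hf'.contDiffAt), fun p _ =>
    ⟨f, h.isSmoothLiftAt hf.contDiffAt, ?_⟩⟩
  have hinv : ∀ v, fderiv ℝ f p (fderiv ℝ f' (f p) v) = v := by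
    intro v
    have h1 : f ∘ f' = id := funext h.right_inv
    have h2 : HasFDerivAt (f ∘ f') ((fderiv ℝ f (f' (f p))).comp (fderiv ℝ f' (f p))) (f p) :=
      (hf.differentiable (by simp) _).hasFDerivAt.comp _
        (hf'.differentiable (by simp) _).hasFDerivAt
    rw [h1, h.left_inv] at h2
    have h3 := h2.unique (hasFDerivAt_id (f p))
    simpa using congrArg (fun L => L v) h3
  ext v
  simp only [Submodule.mem_map, LinearMap.mem_ker, ContinuousLinearMap.coe_coe]
  constructor
  · rintro ⟨w, hw, rfl⟩
    rw [hα, hw, mul_zero]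
  · intro hv
    refine ⟨fderiv ℝ f' (f p) v, ?_, hinv v⟩
    have h1 := hα p (fderiv ℝ f' (f p) v)
    rw [hinv, hv] at h1
    exact (mul_eq_zero.1 h1.symm).resolve_left (ha p)

end IsLiftedAut

theorem c0Tendsto_homeo {U : Set (Jet n)} {fs fs' : ℕ → Cover n → Cover n} {f f' : Cover n → Cover n}
    (hs : ∀ m, IsLiftedAut U (fs m) (fs' m)) (h : IsLiftedAut U f f')
    (hcs : ∀ m, Continuous (fs m)) (hcs' : ∀ m, Continuous (fs' m)) (hc : Continuous f)
    (hc' : Continuous f') (hlim : TendstoUniformly fs f atTop) :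
    C0Tendsto (fun m => (hs m).homeo (hcs m) (hcs' m)) (h.homeo hc hc') := by
  refine ContinuousMap.tendsto_of_tendstoLocallyUniformly
    (TendstoUniformly.tendstoLocallyUniformly ?_)
  rw [Metric.tendstoUniformly_iff] at hlim ⊢
  intro η hη
  filter_upwards [hlim (η / 2) (half_pos hη)] with m hm q
  exact (dist_descend_le h.equivariant (hs m).equivariant (fun p => (hm p).le) q).trans_lt
    (half_lt_self hη)

section zeroSection

variable {ρy : (Fin n → ℝ) → ℝ} {dy dz : ℕ} {g : ℝ → ℝ} {r₀ c : ℝ} {F : ℝ → ℝ}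

theorem hamVF_ham (hρ : IsAdmissibleRho ρy dy dz) (hg : IsProfile g r₀ dy dz)
    (hgF : ∀ r, 0 < r → r < c → g r = F (-Real.log r)) {p : Cover n}
    (hp : proj p ∈ BVstar (rho ρy dz) c) :
    hamVF (ham F (rho ρy dz)) p = field g ρy dy dz p := by
  have hpos : 0 < rho ρy dz p.2 := hρ.rho_pos hp.2
  rw [← hamVF_radialHam hρ (hg.hasDerivAt hpos).differentiableAt]
  refine hamVF_congr ?_
  have h1 : ∀ᶠ q : Cover n in 𝓝 p, rho ρy dz q.2 ∈ Ioo 0 c :=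
    (hρ.continuous_rho.comp continuous_snd).continuousAt.eventually (Ioo_mem_nhds hpos hp.1)
  filter_upwards [h1] with q hq
  rw [ham, radialHam, proj_snd, hgF _ hq.1 hq.2]

/-- Maps fixing `{ρ ≥ r₀}` preserve `{ρ < c}`. -/
theorem rho_lt_of_leftInverse {f f' : Cover n → Cover n} (hinv : ∀ p, f' (f p) = p) (hc : r₀ < c)
    (hfix : ∀ p : Cover n, r₀ ≤ rho ρy dz p.2 → f' p = p) {p : Cover n}
    (hp : rho ρy dz p.2 < c) : rho ρy dz (f p).2 < c := by
  by_contra! h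
  have h1 := hfix (f p) (hc.le.trans h)
  rw [hinv] at h1
  rw [← h1] at h
  linarith

variable {δ : ℕ → ℝ} {φ : ℕ → ℝ → Cover n → Cover n} {Φ : ℝ → Cover n → Cover n}

theorem IsTruncatedFlow.isLiftedAut (h : IsTruncatedFlow g r₀ ρy dy dz δ φ) (hc : r₀ < c) (m : ℕ)
    (t : ℝ) : IsLiftedAut (BV (JetTorus.rho ρy dz) c) (φ m t) (φ m (-t)) where
  equivariant := h.add_translate m t
  equivariant' := h.add_translate m (-t)
  left_inv := h.neg_comp m t
  right_inv := h.comp_neg m t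
  mem _ hp := rho_lt_of_leftInverse (h.neg_comp m t) hc (fun _ => h.eq_self_of_le m (-t)) hp
  mem' _ hp := rho_lt_of_leftInverse (h.comp_neg m t) hc (fun _ => h.eq_self_of_le m t) hp

theorem IsLimitFlow.comp_neg (h : IsLimitFlow g r₀ ρy dy dz δ φ Φ) (t : ℝ) (p : Cover n) :
    Φ t (Φ (-t) p) = p := by
  simpa using h.neg_comp (-t) p

theorem IsLimitFlow.isLiftedAut (h : IsLimitFlow g r₀ ρy dy dz δ φ Φ) (hc : r₀ < c) (t : ℝ) :
    IsLiftedAut (BV (rho ρy dz) c) (Φ t) (Φ (-t)) where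
  equivariant := h.add_translate t
  equivariant' := h.add_translate (-t)
  left_inv := h.neg_comp t
  right_inv := h.comp_neg t
  mem _ hp := rho_lt_of_leftInverse (h.neg_comp t) hc (fun _ => h.eq_self_of_le (-t)) hp
  mem' _ hp := rho_lt_of_leftInverse (h.comp_neg t) hc (fun _ => h.eq_self_of_le t) hp

theorem IsLimitFlow.isLiftedAut_star (h : IsLimitFlow g r₀ ρy dy dz δ φ Φ) (hc : r₀ < c) (t : ℝ) :
    IsLiftedAut (BVstar (rho ρy dz) c) (Φ t) (Φ (-t)) where
  equivariant := h.add_translate t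
  equivariant' := h.add_translate (-t)
  left_inv := h.neg_comp t
  right_inv := h.comp_neg t
  mem p hp := ⟨(h.isLiftedAut hc t).mem p hp.1, h.snd_ne_zero t hp.2⟩
  mem' p hp := ⟨(h.isLiftedAut hc t).mem' p hp.1, h.snd_ne_zero (-t) hp.2⟩

/-- This is the common support of all approximating maps; `r₀ < c` keeps it inside `B_V`. -/
theorem IsAdmissibleRho.isCompact_sublevel_BV (hρ : IsAdmissibleRho ρy dy dz) (hc : r₀ < c) :
    IsCompact {q : BV (rho ρy dz) c | rho ρy dz (q : Jet n).2 ≤ r₀} := by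
  rw [Subtype.isCompact_iff]
  have : (Subtype.val '' {q : BV (rho ρy dz) c | rho ρy dz (q : Jet n).2 ≤ r₀})
      = (univ : Set (Fin n → UnitAddCircle)) ×ˢ {w | rho ρy dz w ≤ r₀} := by
    ext q
    constructor
    · rintro ⟨q, hq, rfl⟩
      exact ⟨trivial, hq⟩
    · rintro ⟨-, hq⟩
      exact ⟨⟨q, hq.trans_lt hc⟩, hq, rfl⟩
  rw [this]
  exact isCompact_univ.prod (hρ.isCompact_sublevel r₀)

end zeroSection

/-- A function on the cover invariant under translations in `x`, evaluated over `q`. -/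
theorem eq_of_translate {a : Cover n → ℝ} (ha : ∀ p (x : Fin n → ℝ), a (p.1 + x, p.2) = a p)
    (p : Cover n) : a (0, p.2) = a p := by
  simpa using (ha (0, p.2) p.1).symm

end JetTorus

end

/-! ### The main theorem -/

open JetTorus
theorem proposition5p5 (n dy dz : ℕ) (ρy : (Fin n → ℝ) → ℝ)
    (hρ : JetTorus.IsAdmissibleRho ρy dy dz)
    (c : ℝ) (hc : 0 < c) (F : ℝ → ℝ) (hF : JetTorus.IsAdmissibleF F c dy dz) :
    ∃ φ : ℝ → JetTorus.BVstar (JetTorus.rho ρy dz) c → JetTorus.BVstar (JetTorus.rho ρy dz) c,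
      -- `φ` is the Hamiltonian flow on the complement of the zero section
      JetTorus.IsHamFlow (JetTorus.ham F (JetTorus.rho ρy dz)) φ ∧
      (∀ φ', JetTorus.IsHamFlow (JetTorus.ham F (JetTorus.rho ρy dz)) φ' → φ' = φ) ∧
      (∀ t, JetTorus.IsDiffeo (φ t)) ∧
      ∀ t : ℝ, ∃ ψ : JetTorus.BV (JetTorus.rho ρy dz) c ≃ₜ JetTorus.BV (JetTorus.rho ρy dz) c,
        -- `ψ` extends `φ t` by the identity and is a contact homeomorphism
        (∀ p : JetTorus.BVstar (JetTorus.rho ρy dz) c,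
          (ψ ⟨p, JetTorus.BVstar_subset _ _ p.2⟩ : JetTorus.Jet n) = φ t p) ∧
        (∀ p : JetTorus.BV (JetTorus.rho ρy dz) c, (p : JetTorus.Jet n).2 = 0 → ψ p = p) ∧
        JetTorus.IsContactHomeo ψ ∧
        (0 < t → Tendsto F atTop atBot →
          ∃ (ψs : ℕ → JetTorus.BV (JetTorus.rho ρy dz) c ≃ₜ JetTorus.BV (JetTorus.rho ρy dz) c)
            (fs : ℕ → JetTorus.BV (JetTorus.rho ρy dz) c → ℝ)
            (f : JetTorus.BV (JetTorus.rho ρy dz) c → ℝ),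
            (∀ m, JetTorus.IsContactomorphism (ψs m)) ∧
            (∃ K : Set (JetTorus.BV (JetTorus.rho ρy dz) c), IsCompact K ∧
              ∀ m, ∀ p ∉ K, ψs m p = p) ∧
            JetTorus.C0Tendsto ψs ψ ∧
            (∀ m, JetTorus.IsSmoothFun (fs m)) ∧
            (∀ m, JetTorus.PullsBackAlpha (ψs m) (fs m)) ∧
            TendstoUniformly fs f atTop ∧
            Continuous f ∧ (∀ p, 0 ≤ f p) ∧
            JetTorus.PullsBackAlpha (φ t)
              (fun p => f ⟨p, JetTorus.BVstar_subset _ _ p.2⟩) ∧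
            (∀ p : JetTorus.BV (JetTorus.rho ρy dz) c, (p : JetTorus.Jet n).2 = 0 → f p = 0)) := by
  obtain ⟨g, r₀, hg, hr₀c, hgF⟩ := hF.exists_isProfile hc
  obtain ⟨δ, φ, h⟩ := exists_isTruncatedFlow (n := n) hρ hg
  obtain ⟨Φ, hΦ⟩ := h.exists_isLimitFlow
  have hham : ∀ p : Cover n, proj p ∈ BVstar (rho ρy dz) c →
      hamVF (ham F (rho ρy dz)) p = field g ρy dy dz p := fun p hp => hamVF_ham hρ hg hgF hp
  have hstar := fun t => hΦ.isLiftedAut_star hr₀c t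
  have hcd : ∀ t (p : Cover n), proj p ∈ BVstar (rho ρy dz) c → ContDiffAt ℝ ∞ (Φ t) p :=
    fun t p hp => hΦ.contDiffAt hp.2 t
  refine ⟨fun t => (hstar t).equiv, fun q => ⟨?_, ?_⟩, fun φ' hφ' => ?_,
    fun t => (hstar t).isDiffeo (hcd t) (hcd (-t)), fun t => ?_⟩
  · obtain ⟨p, hp⟩ := proj_surjective (q : Jet n)
    refine Subtype.ext ?_
    change descend (Φ 0) q = q
    rw [← hp, descend_proj (hΦ.add_translate 0), hΦ.zero]
  · obtain ⟨p, hp⟩ := proj_surjective (q : Jet n)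
    have hpU : proj p ∈ BVstar (rho ρy dz) c := hp ▸ q.2
    refine ⟨fun t => Φ t p, fun t => ⟨?_, ?_⟩⟩
    · change proj (Φ t p) = descend (Φ t) q
      rw [← hp, descend_proj (hΦ.add_translate t)]
    · rw [hham _ ((hstar t).mem p hpU)]
      exact hΦ.hasDerivAt hpU.2 t
  · funext t q
    obtain ⟨h0, Γ, hΓ⟩ := hφ' q
    have hmem : ∀ s, proj (Γ s) ∈ BVstar (rho ρy dz) c := fun s => (hΓ s).1 ▸ (φ' s q).2
    -- The lift `Γ` may start at any point over `q`; equivariance of `Φ t` makes the choice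
    -- irrelevant after projection.
    have hcurve := hΦ.eq_of_hasDerivAt (fun s => hham _ (hmem s) ▸ (hΓ s).2)
      (fun s => (hmem s).2) t
    refine Subtype.ext ?_
    change (φ' t q : Jet n) = descend (Φ t) q
    rw [← (hΓ t).1, hcurve, ← descend_proj (hΦ.add_translate t), (hΓ 0).1]
    exact congrArg (fun x => descend (Φ t) (Subtype.val x)) h0
  have haut := hΦ.isLiftedAut hr₀c t
  have hauts := fun m => h.isLiftedAut hr₀c m t
  have hcs : ∀ m s, Continuous (φ m s) := fun m s => (h.contDiff m s).continuous
  have hcontact : ∀ m, IsContactomorphism (hauts m).equiv := fun m =>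
    (hauts m).isContactomorphism (h.contDiff m t) (h.contDiff m (-t))
      (a := truncFactor g ρy dz δ φ m t) (fun p => (Real.exp_pos _).ne') (h.alpha_fderiv m t)
  have htend := c0Tendsto_homeo hauts haut (fun m => hcs m t) (fun m => hcs m (-t))
    (hΦ.continuous t) (hΦ.continuous (-t)) (hΦ.tendstoUniformly t)
  refine ⟨haut.homeo (hΦ.continuous t) (hΦ.continuous (-t)), fun p => rfl, fun q hq => ?_,
    ⟨_, hcontact, htend⟩, fun ht hFlim => ?_⟩
  · obtain ⟨p, hp⟩ := proj_surjective (q : Jet n)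
    refine Subtype.ext ?_
    change descend (Φ t) q = q
    rw [← hp, descend_proj (hΦ.add_translate t), hΦ.eq_self t p]
    rw [← proj_snd, hp, hq]
  have hglim : Tendsto g (𝓝[>] 0) atBot := by
    refine (hFlim.comp (tendsto_neg_atBot_atTop.comp Real.tendsto_log_nhdsGT_zero)).congr' ?_
    filter_upwards [Ioo_mem_nhdsGT hc] with r hr using (hgF r hr.1 hr.2).symm
  -- The conformal factors are invariant under translations in `x`, so evaluating them at `x = 0`
  -- gives functions on the quotient without choosing lifts.
  have hunif := (hΦ.tendstoUniformly_factor hglim ht).comp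
    fun q : BV (rho ρy dz) c => ((0, (q : Jet n).2) : Cover n)
  have hval : ∀ m p, truncFactor g ρy dz δ φ m t (0, p.2) = truncFactor g ρy dz δ φ m t p :=
    fun m => eq_of_translate (h.truncFactor_translate m t)
  refine ⟨_, fun m q => truncFactor g ρy dz δ φ m t (0, (q : Jet n).2),
    fun q => limitFactor Φ t (0, (q : Jet n).2), hcontact,
    ⟨_, hρ.isCompact_sublevel_BV hr₀c, fun m q hq => ?_⟩, htend, fun m p hp => ?_, fun m p hp => ?_,
    hunif, ?_, fun q => hΦ.limitFactor_nonneg t _, fun p hp => ?_, fun q hq => if_pos hq⟩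
  · obtain ⟨p, hp⟩ := proj_surjective (q : Jet n)
    refine Subtype.ext ?_
    change descend (φ m t) q = q
    rw [← hp, descend_proj (h.add_translate m t), h.eq_self_of_le m t]
    rw [← proj_snd, hp]
    exact le_of_not_ge hq
  · exact ⟨_, (h.contDiff_truncFactor m t).contDiffAt, Eventually.of_forall fun q hq => hval m q⟩
  · refine ⟨_, (hauts m).isSmoothLiftAt (h.contDiff m t).contDiffAt, fun v => ?_⟩
    rw [h.alpha_fderiv]
    exact congrArg (· * alpha p v) (hval m p).symm
  · refine hunif.continuous (Frequently.of_forall fun m => ?_)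
    exact (h.contDiff_truncFactor m t).continuous.comp
      (continuous_const.prodMk (continuous_snd.comp continuous_subtype_val))
  · refine ⟨_, (hstar t).isSmoothLiftAt (hcd t p hp), fun v => ?_⟩
    rw [hΦ.alpha_fderiv hp.2]
    exact congrArg (· * alpha p v) (eq_of_translate (hΦ.limitFactor_translate t) p).symm
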